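/- Call a triple $(\chi,q,n)$ of integers with $\chi<0$ and $n>0$ *admissible* if $n\ge\bigl\lceil\tfrac12\bigl(7+\sqrt{49-24\chi}\,\bigr)\bigr\rceil$ and $q=6-\frac{6\chi}{n}$ (so, in particular, $6-\frac{6\chi}{n}$ is an integer). A triangulation of a closed connected surface $M$ is a finite simplicial complex $K$ whose geometric realization is homeomorphic to $M$; it is *$q$-equivelar* if every vertex of $K$ has degree $q$ in the $1$-skeleton of $K$. **Theorem.** For each admissible triple $(\chi,q,n)$ with $n\le 40$ there is a $q$-equivelar triangulation with exactly $n$ vertices of the non-orientable closed connected surface of Euler characteristic $\chi$ and, if $\chi$ is even, then there is also a $q$-equivelar triangulation with exactly $n$ vertices of the orientable closed connected surface of Euler characteristic $\chi$. -/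

import Mathlib

/-- A closed surface: a nonempty connected compact Hausdorff space in which every point has an
open neighbourhood homeomorphic to an open subset of the Euclidean plane (second countability
follows from compactness). -/
structure IsClosedSurface (X : Type*) [TopologicalSpace X] : Prop where
  t2 : T2Space X
  compact : CompactSpace X
  connected : ConnectedSpace X
  locallyEuclidean :
    ∀ x : X, ∃ e : OpenPartialHomeomorph X (EuclideanSpace ℝ (Fin 2)), x ∈ e.source

namespace AbstractSimplicialComplex

variable {V : Type*}

/-- The geometric realization `|K|` of a finite simplicial complex `K` with vertex set `V`,
in barycentric coordinates: the union, over the faces `s` of `K`, of the simplices spanned by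
the unit vectors indexed by `s`. -/
def realization [Fintype V] (K : AbstractSimplicialComplex V) : Set (V → ℝ) :=
  {x | x ∈ stdSimplex ℝ V ∧ ∃ s ∈ K.faces, ∀ v, v ∉ s → x v = 0}

/-- `K` is a triangulation of a closed surface: its geometric realization, with the topology
induced by that of `V → ℝ`, is a closed surface. -/
def IsSurfaceTriangulation [Fintype V] (K : AbstractSimplicialComplex V) : Prop :=
  IsClosedSurface K.realization

/-- `K.fNumber i` is the number of `i`-dimensional faces of `K`. -/
noncomputable def fNumber (K : AbstractSimplicialComplex V) (i : ℕ) : ℕ :=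
  {s : Finset V | s ∈ K.faces ∧ s.card = i + 1}.ncard

/-- The Euler characteristic `f₀ - f₁ + f₂ - ⋯` of `K`, hence of `|K|`. -/
noncomputable def eulerChar [Fintype V] (K : AbstractSimplicialComplex V) : ℤ :=
  ∑ i ∈ Finset.range (Fintype.card V), (-1) ^ i * (K.fNumber i : ℤ)

/-- The degree of a vertex in the `1`-skeleton of `K`. -/
noncomputable def vertexDegree [DecidableEq V] (K : AbstractSimplicialComplex V) (v : V) : ℕ :=
  {w : V | w ≠ v ∧ {v, w} ∈ K.faces}.ncard

/-- `K` is `q`-equivelar: every vertex has degree `q`. -/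
def IsEquivelar [DecidableEq V] (K : AbstractSimplicialComplex V) (q : ℕ) : Prop :=
  ∀ v, K.vertexDegree v = q

/-- Orientability of a triangulated closed surface: the triangles can be oriented coherently.
Here `O a b c` means that `{a, b, c}` is a triangle of `K` which carries the orientation
`a → b → c → a`.  Every triangle carries exactly one of its two orientations, and no two
triangles induce the same direction on a common edge. -/
def IsOrientable [DecidableEq V] (K : AbstractSimplicialComplex V) : Prop :=
  ∃ O : V → V → V → Prop,
    (∀ a b c, O a b c → O b c a) ∧
    (∀ a b c, O a b c → a ≠ b ∧ b ≠ c ∧ a ≠ c ∧ {a, b, c} ∈ K.faces) ∧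
    (∀ a b c, a ≠ b → b ≠ c → a ≠ c → {a, b, c} ∈ K.faces → (O a b c ↔ ¬ O b a c)) ∧
    (∀ a b c d, O a b c → O a b d → c = d)

end AbstractSimplicialComplex

/-- A triple `(χ, q, n)` is admissible if `χ < 0`, `n ≥ ⌈(7 + √(49 - 24 χ)) / 2⌉`
and the integer `q` equals `6 - 6 χ / n`. -/
def IsAdmissibleTriple (χ : ℤ) (q n : ℕ) : Prop :=
  χ < 0 ∧ ⌈(7 + √(49 - 24 * (χ : ℝ))) / 2⌉ ≤ (n : ℤ) ∧ (q : ℝ) = 6 - 6 * (χ : ℝ) / (n : ℝ)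

/-!
For an admissible triple one has `7 ≤ q ≤ n - 1` and `6 * χ = n * (6 - q)`, so that for `n ≤ 40`
there are only finitely many pairs `(n, q)`. For each of them a triangulation is given explicitly.
What has to be proved is that finitely many arithmetic conditions on such a list imply the
topological statement.

The triangulations are described by rotation systems: each vertex `v` has `q` neighbours
`nbr v 0, …, nbr v (q - 1)` in cyclic order, and the facets are the triangles
`{v, nbr v i, nbr v (i + 1)}`. If the cyclic orders at the two ends of each edge fit together
(`RotationSystem.exists_edge`), then each triangle is seen from all its vertices, and so the link of
each vertex is a `q`-cycle (`RotationSystem.hasCyclicLink`).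

The open star of a vertex `v` whose link is a `q`-cycle is homeomorphic to the plane
(`AbstractSimplicialComplex.HasCyclicLink.starChart`): the quotients `x w / x v` of barycentric
coordinates, for the neighbours `w` of `v`, are used as coefficients of the vertices of a regular
`q`-gon. The inverse is given by the piecewise linear hat functions of the fan spanned by the
polygon, and each of these is an explicit continuous function, the positive part of the minimum of
two linear functions (`hat_cone`). Open stars cover the realization, which is therefore a closed
surface as soon as the `1`-skeleton is connected.

Double counting of incidences gives `6 * χ = n * (6 - q)` (`RotationSystem.six_mul_eulerChar`).
At each edge the rotations at its two ends turn either in the same sense or in opposite senses. If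
they turn in the same sense at all edges, the rotations orient the triangles
(`RotationSystem.isOrientable`). Conversely, an orientation agrees with the rotation at a vertex
either everywhere or nowhere, and so a single edge of the second kind excludes an orientation when
the edges of the first kind connect all vertices (`RotationSystem.not_isOrientable`).

The rotation systems in the list have the vertex set `ℤ / n` and are invariant under a translation
by some `k`, mostly with `k ≤ 3`, so that only the neighbours of `0, …, k - 1` have to be recorded;
moreover the edges `{v, v + 1}` occur and make connectedness evident. The conditions on the list
are decided by evaluation in the kernel.
-/

/-! ### Piecewise linear coordinates on the plane -/

section Fan

open Complex

variable {q : ℕ} [NeZero q]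

/-- The `i`-th of the `q`-th roots of unity, the vertices of a regular `q`-gon. -/
noncomputable def polygonVertex (i : ZMod q) : ℂ := ZMod.stdAddChar i

/-- `sin (2 * π * i / q)`. -/
noncomputable def polygonSin (i : ZMod q) : ℝ := (polygonVertex i).im

/-- For `5 ≤ q`, the piecewise linear function on the plane which takes the value `1` at the `k`-th
vertex of the regular `q`-gon, vanishes at the other vertices, and is linear on each of the cones
spanned by two consecutive vertices. -/
noncomputable def hat (k : ZMod q) (z : ℂ) : ℝ :=
  max 0 (min (z * polygonVertex (-(k - 1))).im (-(z * polygonVertex (-(k + 1))).im)) /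
    polygonSin (1 : ZMod q)

lemma continuous_hat (k : ZMod q) : Continuous (hat k) := by
  unfold hat
  fun_prop

lemma polygonVertex_add (i j : ZMod q) :
    polygonVertex (i + j) = polygonVertex i * polygonVertex j := by
  simp [polygonVertex, AddChar.map_add_eq_mul]

lemma polygonVertex_zero : polygonVertex (0 : ZMod q) = 1 := by
  simp [polygonVertex]

lemma polygonVertex_eq (m : ℕ) :
    polygonVertex (m : ZMod q) = exp ((2 * Real.pi * m / q : ℝ) * I) := by
  have := ZMod.stdAddChar_coe (N := q) (m : ℤ)
  rw [polygonVertex]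
  push_cast at this ⊢
  rw [this]
  congr 1
  ring

lemma polygonSin_natCast (m : ℕ) : polygonSin (m : ZMod q) = Real.sin (2 * Real.pi * m / q) := by
  rw [polygonSin, polygonVertex_eq, Complex.exp_ofReal_mul_I_im]

lemma polygonSin_neg (i : ZMod q) : polygonSin (-i) = -polygonSin i := by
  have h : polygonVertex (-i) = starRingEnd ℂ (polygonVertex i) := by
    simp [polygonVertex, AddChar.map_neg_eq_conj]
  rw [polygonSin, h, Complex.conj_im, polygonSin]

lemma polygonSin_zero : polygonSin (0 : ZMod q) = 0 := by
  simp [polygonSin, polygonVertex_zero]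

lemma polygonSin_natCast_nonneg {m : ℕ} (h : 2 * m ≤ q) : 0 ≤ polygonSin (m : ZMod q) := by
  have hq : (0 : ℝ) < q := by exact_mod_cast Nat.pos_of_ne_zero (NeZero.ne q)
  rw [polygonSin_natCast]
  apply Real.sin_nonneg_of_nonneg_of_le_pi
  · positivity
  · rw [div_le_iff₀ hq]
    have : (2 * m : ℝ) ≤ q := by exact_mod_cast h
    nlinarith [Real.pi_pos]

lemma polygonSin_natCast_nonpos {m : ℕ} (h : q ≤ 2 * m) (h' : m ≤ q) :
    polygonSin (m : ZMod q) ≤ 0 := by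
  have h1 : ((m : ℕ) : ZMod q) = -((q - m : ℕ) : ZMod q) := by
    rw [Nat.cast_sub h']; simp
  rw [h1, polygonSin_neg, neg_nonpos]
  exact polygonSin_natCast_nonneg (by omega)

lemma polygonSin_one_pos (hq : 5 ≤ q) : 0 < polygonSin (1 : ZMod q) := by
  have hq' : (5 : ℝ) ≤ q := by exact_mod_cast hq
  have := polygonSin_natCast (q := q) 1
  rw [Nat.cast_one] at this
  rw [this]
  apply Real.sin_pos_of_pos_of_lt_pi
  · have := Real.pi_pos
    positivity
  · rw [div_lt_iff₀ (by linarith)]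
    push_cast
    nlinarith [Real.pi_pos]

lemma im_cone_mul (s t : ℝ) (i : ZMod q) :
    (((s : ℂ) + t * polygonVertex (1 : ZMod q)) * polygonVertex i).im =
      s * polygonSin i + t * polygonSin (1 + i) := by
  rw [add_mul, mul_assoc, ← polygonVertex_add]
  simp [polygonSin]

/-- The values of the hat functions on the cone spanned by the vertices `0` and `1`. -/
lemma hat_first_cone (hq : 5 ≤ q) {s t : ℝ} (hs : 0 ≤ s) (ht : 0 ≤ t) (k : ZMod q) :
    hat k ((s : ℂ) + t * polygonVertex (1 : ZMod q)) =
      (Pi.single 0 s + Pi.single 1 t : ZMod q → ℝ) k := by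
  have : Fact (1 < q) := ⟨by omega⟩
  have h1 : 0 < polygonSin (1 : ZMod q) := polygonSin_one_pos hq
  have h2 : 0 ≤ polygonSin (2 : ZMod q) := by
    have := polygonSin_natCast_nonneg (q := q) (m := 2) (by omega)
    exact_mod_cast this
  rw [hat, im_cone_mul, im_cone_mul]
  rcases eq_or_ne k 0 with rfl | h0
  · have e1 : (1 : ZMod q) + -(0 - 1) = 2 := by ring
    have e2 : (1 : ZMod q) + -(0 + 1) = 0 := by ring
    have e3 : -(0 - 1 : ZMod q) = 1 := by ring
    rw [e1, e2, e3, polygonSin_neg, zero_add, polygonSin_zero, min_eq_right, max_eq_right]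
    · simp [h1.ne']
    · nlinarith
    · nlinarith [mul_nonneg ht h2]
  rcases eq_or_ne k 1 with rfl | h1'
  · have e1 : (1 : ZMod q) + -(1 - 1) = 1 := by ring
    have e2 : (1 : ZMod q) + -(1 + 1) = -1 := by ring
    have e3 : -(1 - 1 : ZMod q) = 0 := by ring
    have e4 : -(1 + 1 : ZMod q) = -2 := by ring
    rw [e1, e2, e3, e4, polygonSin_neg, polygonSin_neg, polygonSin_zero, min_eq_left, max_eq_right]
    · simp [h1.ne']
    · nlinarith
    · nlinarith [mul_nonneg hs h2]
  · -- Away from the cone one of the two linear functions in the minimum is nonpositive, since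
    -- the two half planes where they are positive meet in a sector around the `k`-th vertex.
    have hk : (k.val : ZMod q) = k := ZMod.natCast_zmod_val k
    have hlt := ZMod.val_lt k
    have hk2 : 2 ≤ k.val := by
      by_contra! h
      interval_cases hv : k.val
      · exact h0 (by rw [← hk]; simp)
      · exact h1' (by rw [← hk]; simp)
    have e1 : -(k - 1) = -((k.val - 1 : ℕ) : ZMod q) := by
      rw [Nat.cast_sub (by omega), hk]; simp
    have e2 : 1 + -(k - 1) = -((k.val - 2 : ℕ) : ZMod q) := by
      rw [Nat.cast_sub (by omega), hk]; push_cast; ring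
    have e3 : -(k + 1) = -((k.val + 1 : ℕ) : ZMod q) := by
      push_cast [hk]; ring
    have e4 : 1 + -(k + 1) = -(k.val : ZMod q) := by
      rw [hk]; ring
    rw [e4, e3, e2, e1]
    simp only [polygonSin_neg]
    have hmin : max 0 (min (s * -polygonSin ((k.val - 1 : ℕ) : ZMod q) +
        t * -polygonSin ((k.val - 2 : ℕ) : ZMod q))
        (-(s * -polygonSin ((k.val + 1 : ℕ) : ZMod q) + t * -polygonSin (k.val : ZMod q)))) = 0 := by
      apply max_eq_left
      by_cases hc : 2 * (k.val - 1) ≤ q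
      · have a1 := polygonSin_natCast_nonneg hc
        have a2 := polygonSin_natCast_nonneg (q := q) (m := k.val - 2) (by omega)
        exact min_le_of_left_le (by nlinarith [mul_nonneg hs a1, mul_nonneg ht a2])
      · have a1 := polygonSin_natCast_nonpos (q := q) (m := k.val + 1) (by omega) (by omega)
        have a2 := polygonSin_natCast_nonpos (q := q) (m := k.val) (by omega) (by omega)
        exact min_le_of_right_le (by
          nlinarith [mul_nonneg hs (neg_nonneg.2 a1), mul_nonneg ht (neg_nonneg.2 a2)])
    rw [hmin]
    simp [h0, h1']

/-- The values of the hat functions on the cone spanned by the vertices `j` and `j + 1`. -/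
lemma hat_cone (hq : 5 ≤ q) {s t : ℝ} (hs : 0 ≤ s) (ht : 0 ≤ t) (j k : ZMod q) :
    hat k ((s : ℂ) * polygonVertex j + t * polygonVertex (j + 1)) =
      (Pi.single j s + Pi.single (j + 1) t : ZMod q → ℝ) k := by
  have hrot : hat k ((s : ℂ) * polygonVertex j + t * polygonVertex (j + 1)) =
      hat (k - j) ((s : ℂ) + t * polygonVertex (1 : ZMod q)) := by
    have h (i : ZMod q) : ((s : ℂ) * polygonVertex j + t * polygonVertex (j + 1)) *
        polygonVertex (-(k + i)) = ((s : ℂ) + t * polygonVertex (1 : ZMod q)) *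
          polygonVertex (-(k - j + i)) := by
      have : -(k - j + i) = -(k + i) + j := by ring
      rw [this, polygonVertex_add, polygonVertex_add]
      ring
    have h' := h (-1)
    rw [← sub_eq_add_neg, ← sub_eq_add_neg] at h'
    rw [hat, hat, h 1, h']
  rw [hrot, hat_first_cone hq hs ht]
  simp only [Pi.add_apply, Pi.single_apply, sub_eq_iff_eq_add, add_comm j 1, zero_add]

/-- The cones spanned by consecutive vertices of the regular polygon cover the plane. -/
lemma exists_cone (hq : 5 ≤ q) (z : ℂ) : ∃ (j : ZMod q) (s t : ℝ), 0 ≤ s ∧ 0 ≤ t ∧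
    z = (s : ℂ) * polygonVertex j + t * polygonVertex (j + 1) := by
  have hq0 : (0 : ℝ) < q := by exact_mod_cast (by omega : 0 < q)
  have hpi := Real.pi_pos
  set θ : ℝ := 2 * Real.pi / q with hθ
  have hθ0 : 0 < θ := by positivity
  have hθpi : θ ≤ Real.pi := by
    rw [hθ, div_le_iff₀ hq0]
    have : (5 : ℝ) ≤ q := by exact_mod_cast hq
    nlinarith
  have h1 : polygonSin (1 : ZMod q) = Real.sin θ := by
    have := polygonSin_natCast (q := q) 1
    simpa [hθ] using this
  have hsin : 0 < Real.sin θ := h1 ▸ polygonSin_one_pos hq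
  -- Write `arg z + 2 * π = m * θ + β` with `0 ≤ β < θ`.
  set α : ℝ := arg z + 2 * Real.pi with hα
  have hα0 : 0 ≤ α := by linarith [Complex.neg_pi_lt_arg z]
  set m : ℕ := ⌊α / θ⌋₊ with hm
  have hm1 : (m : ℝ) * θ ≤ α := (le_div_iff₀ hθ0).1 (Nat.floor_le (by positivity))
  have hm2 : α < (m + 1 : ℝ) * θ := (div_lt_iff₀ hθ0).1 (Nat.lt_floor_add_one _)
  set β : ℝ := α - m * θ with hβ
  refine ⟨m, ‖z‖ * Real.sin (θ - β) / Real.sin θ, ‖z‖ * Real.sin β / Real.sin θ, ?_, ?_, ?_⟩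
  · have : 0 ≤ Real.sin (θ - β) :=
      Real.sin_nonneg_of_nonneg_of_le_pi (by linarith) (by linarith)
    positivity
  · have : 0 ≤ Real.sin β := Real.sin_nonneg_of_nonneg_of_le_pi (by linarith) (by linarith)
    positivity
  · have hv1 : polygonVertex (1 : ZMod q) = exp (θ * I) := by
      have := polygonVertex_eq (q := q) 1
      rw [Nat.cast_one] at this
      rw [this, hθ]; simp
    have hvm : polygonVertex (m : ZMod q) = exp ((m * θ : ℝ) * I) := by
      rw [polygonVertex_eq, hθ]; congr 3; ring
    have hz : z = ‖z‖ * (exp ((m * θ : ℝ) * I) * exp (β * I)) := by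
      rw [← exp_add, ← add_mul, ← ofReal_add]
      have : m * θ + β = arg z + 2 * Real.pi := by rw [hβ]; ring
      rw [this]
      push_cast
      rw [add_mul, exp_add, exp_two_pi_mul_I, mul_one, norm_mul_exp_arg_mul_I]
    have hkey : (Real.sin θ : ℂ) * exp (β * I) =
        Real.sin (θ - β) + Real.sin β * exp (θ * I) := by
      apply Complex.ext
      · simp [exp_ofReal_mul_I_re, -ofReal_sin, -ofReal_cos, Real.sin_sub, -ofReal_sub]
        ring
      · simp [exp_ofReal_mul_I_im, -ofReal_sin, -ofReal_cos, -ofReal_sub]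
        ring
    rw [polygonVertex_add, hv1, hvm]
    have hne : (Real.sin θ : ℂ) ≠ 0 := by exact_mod_cast hsin.ne'
    generalize exp ((m * θ : ℝ) * I) = a at hz ⊢
    generalize exp (θ * I) = b at hkey ⊢
    rw [ofReal_div, ofReal_div, ofReal_mul, ofReal_mul]
    conv_lhs => rw [hz]
    field_simp
    linear_combination (‖z‖ : ℂ) * a * hkey

end Fan

/-! ### Charts around the vertices of a complex whose vertex links are cycles -/

namespace AbstractSimplicialComplex

variable {V : Type*} [DecidableEq V]

/-- The link of the vertex `v` of `K` is the cycle with the vertices `w 0`, …, `w (q - 1)` in this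
cyclic order. -/
structure HasCyclicLink {q : ℕ} (K : AbstractSimplicialComplex V) (v : V) (w : ZMod q → V) :
    Prop where
  injective : Function.Injective w
  ne : ∀ i, w i ≠ v
  triangle_mem : ∀ i, {v, w i, w (i + 1)} ∈ K.faces
  subset_triangle : ∀ s ∈ K.faces, v ∈ s → ∃ i, s ⊆ {v, w i, w (i + 1)}

section Chart

variable {q : ℕ} [NeZero q] {K : AbstractSimplicialComplex V}
  {v : V} {w : ZMod q → V}

/-- The map from the open star of `v` to the plane which is linear in the barycentric coordinates
up to the projective factor `x v`, and takes the direction of the edge from `v` to `w i` to that of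
the `i`-th vertex of the regular polygon. -/
noncomputable def starMap (v : V) (w : ZMod q → V) (x : V → ℝ) : ℂ :=
  ∑ i, ((x (w i) / x v : ℝ) : ℂ) * polygonVertex i

/-- The barycentric coordinates of the point of the open star of `v` with a given image under
`starMap`, up to normalization. -/
noncomputable def starCoord (v : V) (w : ZMod q → V) (z : ℂ) (u : V) : ℝ :=
  if u = v then 1 else ∑ i, if w i = u then hat i z else 0

lemma continuous_starCoord (v : V) (w : ZMod q → V) (u : V) :
    Continuous fun z => starCoord v w z u := by
  unfold starCoord
  split_ifs
  · fun_prop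
  · refine continuous_finsetSum _ fun i _ => ?_
    split_ifs
    · exact continuous_hat i
    · fun_prop

lemma starCoord_nonneg (v : V) (w : ZMod q → V) (hq : 5 ≤ q) (z : ℂ) (u : V) :
    0 ≤ starCoord v w z u := by
  unfold starCoord
  split_ifs
  · exact zero_le_one
  · refine Finset.sum_nonneg fun i _ => ?_
    split_ifs
    · exact div_nonneg (le_max_left _ _) (polygonSin_one_pos hq).le
    · exact le_rfl

lemma starCoord_self (v : V) (w : ZMod q → V) (z : ℂ) : starCoord v w z v = 1 := by
  simp [starCoord]

lemma sum_starCoord_pos [Fintype V] (v : V) (w : ZMod q → V) (hq : 5 ≤ q) (z : ℂ) :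
    0 < ∑ u, starCoord v w z u := by
  refine Finset.sum_pos' (fun u _ => starCoord_nonneg v w hq z u) ⟨v, Finset.mem_univ _, ?_⟩
  rw [starCoord_self]
  exact zero_lt_one

namespace HasCyclicLink

lemma starCoord_apply (h : K.HasCyclicLink v w) (z : ℂ) (i : ZMod q) :
    starCoord v w z (w i) = hat i z := by
  simp [starCoord, h.ne i, h.injective.eq_iff]

/-- `starCoord` on the cone spanned by two consecutive vertices of the polygon. -/
lemma starCoord_cone (h : K.HasCyclicLink v w) (hq : 5 ≤ q) {s t : ℝ} (hs : 0 ≤ s) (ht : 0 ≤ t)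
    (j : ZMod q) :
    starCoord v w ((s : ℂ) * polygonVertex j + t * polygonVertex (j + 1)) =
      Pi.single v 1 + Pi.single (w j) s + Pi.single (w (j + 1)) t := by
  ext u
  rcases eq_or_ne u v with rfl | hu
  · simp [starCoord, (h.ne _).symm]
  · have hi (i : ZMod q) : (if w i = u then hat i ((s : ℂ) * polygonVertex j +
        t * polygonVertex (j + 1)) else 0) =
        (if j = i then (if w j = u then s else 0) else 0) +
        (if j + 1 = i then (if w (j + 1) = u then t else 0) else 0) := by
      rw [hat_cone hq hs ht, Pi.add_apply, Pi.single_apply, Pi.single_apply]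
      by_cases h1 : w i = u
      · subst h1
        simp only [h.injective.eq_iff, if_true, eq_comm (a := i)]
        split_ifs <;> rfl
      · by_cases h2 : j = i <;> by_cases h3 : j + 1 = i <;> simp_all
    rw [starCoord, if_neg hu, Finset.sum_congr rfl fun i _ => hi i, Finset.sum_add_distrib]
    simp [Pi.single_apply, hu, eq_comm]

variable [Fintype V]

omit [NeZero q] in
/-- A point of the open star of `v` lies in one of the triangles around `v`. -/
lemma exists_coords (h : K.HasCyclicLink v w) (hq : 5 ≤ q) {x : V → ℝ} (hx : x ∈ K.realization)
    (hv : x v ≠ 0) : ∃ j, x = Pi.single v (x v) + Pi.single (w j) (x (w j)) +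
      Pi.single (w (j + 1)) (x (w (j + 1))) := by
  have : Fact (1 < q) := ⟨by omega⟩
  obtain ⟨-, s, hs, hxs⟩ := hx
  obtain ⟨j, hj⟩ := h.subset_triangle s hs (by by_contra hvs; exact hv (hxs v hvs))
  have hjj : w j ≠ w (j + 1) := fun e => by simpa using h.injective e
  refine ⟨j, funext fun u => ?_⟩
  by_cases h0 : u = v
  · subst h0
    simp [(h.ne _).symm]
  by_cases h1 : u = w j
  · subst h1
    simp [h.ne, hjj]
  by_cases h2 : u = w (j + 1)
  · subst h2
    simp [h.ne, hjj.symm]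
  · have : u ∉ s := fun hu => by simpa [h0, h1, h2] using hj hu
    simp [hxs u this, h0, h1, h2]

/-- The point of the open star of `v` with a given image under `starMap`. -/
noncomputable def starPoint (v : V) (w : ZMod q → V) (z : ℂ) (u : V) : ℝ :=
  starCoord v w z u / ∑ u', starCoord v w z u'

lemma continuous_starPoint (hq : 5 ≤ q) : Continuous (starPoint v w) := by
  refine continuous_pi fun u => ?_
  unfold starPoint
  exact (continuous_starCoord v w u).div
    (continuous_finsetSum _ fun u _ => continuous_starCoord v w u)
    fun z => (sum_starCoord_pos v w hq z).ne'

lemma starPoint_mem (h : K.HasCyclicLink v w) (hq : 5 ≤ q) (z : ℂ) :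
    starPoint v w z ∈ K.realization := by
  refine ⟨⟨fun u => div_nonneg (starCoord_nonneg v w hq z u) (sum_starCoord_pos v w hq z).le, ?_⟩,
    ?_⟩
  · simp only [starPoint]
    rw [← Finset.sum_div, div_self (sum_starCoord_pos v w hq z).ne']
  · obtain ⟨j, s, t, hs, ht, rfl⟩ := exists_cone hq z
    refine ⟨_, h.triangle_mem j, fun u hu => ?_⟩
    simp only [Finset.mem_insert, Finset.mem_singleton, not_or] at hu
    simp [starPoint, h.starCoord_cone hq hs ht, hu]

lemma starPoint_self_ne_zero (hq : 5 ≤ q) (z : ℂ) : starPoint v w z v ≠ 0 := by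
  rw [starPoint, starCoord_self]
  exact (div_pos one_pos (sum_starCoord_pos v w hq z)).ne'

lemma starMap_starPoint (h : K.HasCyclicLink v w) (hq : 5 ≤ q) (z : ℂ) :
    starMap v w (starPoint v w z) = z := by
  have hsum := (sum_starCoord_pos v w hq z).ne'
  have h1 (i : ZMod q) : starPoint v w z (w i) / starPoint v w z v = hat i z := by
    rw [starPoint, starPoint, starCoord_self, h.starCoord_apply]
    field_simp
  simp only [starMap, h1]
  obtain ⟨j, s, t, hs, ht, rfl⟩ := exists_cone hq z
  simp only [hat_cone hq hs ht, Pi.add_apply, Pi.single_apply, Complex.ofReal_add, add_mul,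
    Finset.sum_add_distrib, apply_ite Complex.ofReal, Complex.ofReal_zero, ite_mul, zero_mul,
    Finset.sum_ite_eq', Finset.mem_univ, if_true]

lemma starPoint_starMap (h : K.HasCyclicLink v w) (hq : 5 ≤ q) {x : V → ℝ}
    (hx : x ∈ K.realization) (hv : x v ≠ 0) : starPoint v w (starMap v w x) = x := by
  have : Fact (1 < q) := ⟨by omega⟩
  obtain ⟨j, hj⟩ := h.exists_coords hq hx hv
  have hjj : j ≠ j + 1 := fun e => by simp at e
  have hmap : starMap v w x = ((x (w j) / x v : ℝ) : ℂ) * polygonVertex j +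
      ((x (w (j + 1)) / x v : ℝ) : ℂ) * polygonVertex (j + 1) := by
    have h0 (i : ZMod q) (hi : i ≠ j ∧ i ≠ j + 1) :
        ((x (w i) / x v : ℝ) : ℂ) * polygonVertex i = 0 := by
      rw [hj]
      simp [h.ne, h.injective.eq_iff, hi]
    rw [starMap, Fintype.sum_eq_add j (j + 1) hjj h0]
  have hpos : ∀ u, 0 ≤ x u := hx.1.1
  have hcoord : starCoord v w (starMap v w x) = (x v)⁻¹ • x := by
    rw [hmap, h.starCoord_cone hq (div_nonneg (hpos _) (hpos _)) (div_nonneg (hpos _) (hpos _))]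
    ext u
    rw [Pi.smul_apply, smul_eq_mul, congrFun hj u]
    simp [Pi.single_apply, hv, mul_add, div_eq_inv_mul]
  have hsum : ∑ u, starCoord v w (starMap v w x) u = (x v)⁻¹ := by
    simp [hcoord, ← Finset.mul_sum, hx.1.2]
  ext u
  rw [starPoint, hsum, hcoord, Pi.smul_apply, smul_eq_mul]
  field_simp

/-- The open star of a vertex with a cyclic link is homeomorphic to the plane. -/
noncomputable def starChart (h : K.HasCyclicLink v w) (hq : 5 ≤ q) :
    OpenPartialHomeomorph K.realization ℂ where
  toFun x := starMap v w x
  invFun z := ⟨starPoint v w z, h.starPoint_mem hq z⟩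
  source := {x | (x : V → ℝ) v ≠ 0}
  target := Set.univ
  map_source' _ _ := Set.mem_univ _
  map_target' z _ := starPoint_self_ne_zero hq z
  left_inv' x hx := Subtype.ext (h.starPoint_starMap hq x.2 hx)
  right_inv' z _ := h.starMap_starPoint hq z
  open_source := by
    exact isOpen_ne.preimage ((continuous_apply v).comp continuous_subtype_val)
  open_target := isOpen_univ
  continuousOn_toFun := by
    unfold starMap
    refine continuousOn_finsetSum _ fun i _ => ContinuousOn.mul ?_ continuousOn_const
    refine Complex.continuous_ofReal.comp_continuousOn (ContinuousOn.div ?_ ?_ fun x hx => hx)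
    all_goals exact ((continuous_apply _).comp continuous_subtype_val).continuousOn
  continuousOn_invFun := ((continuous_starPoint hq).subtype_mk _).continuousOn

end HasCyclicLink
end Chart

/-! ### The realization as a closed surface -/

section Realization

variable [Fintype V] {K : AbstractSimplicialComplex V}

omit [DecidableEq V] in
lemma isCompact_realization (K : AbstractSimplicialComplex V) : IsCompact K.realization := by
  have : K.realization =
      ⋃ s ∈ {s | s ∈ K.faces}, stdSimplex ℝ V ∩ ⋂ v ∈ {v | v ∉ s}, {x | x v = 0} := by
    ext x
    simp [realization]
  rw [this]
  refine (Set.toFinite _).isCompact_biUnion fun s _ => (isCompact_stdSimplex ℝ V).inter_right ?_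
  exact isClosed_biInter fun v _ => isClosed_eq (continuous_apply v) continuous_const

lemma joinedIn_single_of_mem_face {x : V → ℝ} (hx : x ∈ stdSimplex ℝ V) {s : Finset V}
    (hs : s ∈ K.faces) (hxs : ∀ v, v ∉ s → x v = 0) {u : V} (hu : u ∈ s) :
    JoinedIn K.realization x (Pi.single u 1) := by
  refine JoinedIn.of_segment_subset fun y hy => ?_
  refine ⟨(convex_stdSimplex ℝ V).segment_subset hx (single_mem_stdSimplex ℝ u) hy, s, hs,
    fun v hv => ?_⟩
  obtain ⟨a, b, -, -, -, rfl⟩ := hy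
  have : v ≠ u := fun e => hv (e ▸ hu)
  simp [hxs v hv, this]

lemma connectedSpace_realization [Nonempty V]
    (h : ∀ u v, Relation.ReflTransGen (fun a b => {a, b} ∈ K.faces) u v) :
    ConnectedSpace K.realization := by
  have hmem (u : V) : Pi.single u 1 ∈ K.realization :=
    ⟨single_mem_stdSimplex ℝ u, {u}, K.singleton_mem u, fun v hv => by simp_all⟩
  have hjoin (u v : V) : JoinedIn K.realization (Pi.single u 1) (Pi.single v (1 : ℝ)) := by
    induction h u v with
    | refl => exact JoinedIn.refl (hmem u)
    | @tail b c _ hbc ih =>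
      refine ih.trans (joinedIn_single_of_mem_face (single_mem_stdSimplex ℝ b) hbc
        (fun v hv => ?_) (by simp))
      have : v ≠ b := by rintro rfl; simp at hv
      simp [this]
  let u₀ : V := Classical.arbitrary V
  refine isConnected_iff_connectedSpace.1 (IsPathConnected.isConnected
    ⟨_, hmem u₀, fun {x} hx => ?_⟩)
  obtain ⟨hx', s, hs, hxs⟩ := hx
  obtain ⟨u, hu⟩ := (K.isRelLowerSet_faces hs).1
  exact (hjoin u₀ u).trans (joinedIn_single_of_mem_face hx' hs hxs hu).symm

/-- A connected complex all of whose vertex links are cycles triangulates a closed surface. -/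
theorem isSurfaceTriangulation_of_hasCyclicLink [Nonempty V] {q : ℕ} (hq : 5 ≤ q)
    {w : V → ZMod q → V} (hlink : ∀ v, K.HasCyclicLink v (w v))
    (hconn : ∀ u v, Relation.ReflTransGen (fun a b => {a, b} ∈ K.faces) u v) :
    K.IsSurfaceTriangulation where
  t2 := inferInstance
  compact := isCompact_iff_compactSpace.1 K.isCompact_realization
  connected := connectedSpace_realization hconn
  locallyEuclidean x := by
    have : NeZero q := ⟨by omega⟩
    obtain ⟨v, hv⟩ : ∃ v, (x : V → ℝ) v ≠ 0 := by
      by_contra! h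
      have := x.2.1.2
      simp [h] at this
    exact ⟨((hlink v).starChart hq).transHomeomorph
      Complex.orthonormalBasisOneI.repr.toHomeomorph, hv⟩

end Realization

end AbstractSimplicialComplex

/-! ### Signed rotation systems -/

/-- A triangular signed rotation system: a cyclic order `nbr v 0, …, nbr v (q - 1)` of neighbours of
each vertex `v`, such that around each edge from `v` to `w = nbr v i` the orders at `v` and `w` fit
to two triangles `{v, w, nbr v (i - 1)}` and `{v, w, nbr v (i + 1)}` which share the edge. The two
orders turn around the edge either in the same sense or in opposite senses. -/
structure RotationSystem (V : Type*) (q : ℕ) where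
  /-- the `i`-th neighbour of `v` -/
  nbr : V → ZMod q → V
  nbr_injective : ∀ v, Function.Injective (nbr v)
  nbr_ne : ∀ v i, nbr v i ≠ v
  exists_edge : ∀ v i, ∃ p, nbr (nbr v i) p = v ∧
    ((nbr (nbr v i) (p + 1) = nbr v (i - 1) ∧ nbr (nbr v i) (p - 1) = nbr v (i + 1)) ∨
      (nbr (nbr v i) (p + 1) = nbr v (i + 1) ∧ nbr (nbr v i) (p - 1) = nbr v (i - 1)))

lemma zmod_two_ne_zero {q : ℕ} (hq : 5 ≤ q) : (2 : ZMod q) ≠ 0 := by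
  intro h
  have := (ZMod.natCast_eq_zero_iff 2 q).1 (by exact_mod_cast h)
  exact absurd (Nat.le_of_dvd two_pos this) (by omega)

namespace RotationSystem

variable {V : Type*} {q : ℕ} (R : RotationSystem V q)

/-- The rotations at the ends of the edge from `v` to its `i`-th neighbour turn in the same sense,
with respect to an orientation of the two triangles at this edge. -/
def Preserves (v : V) (i : ZMod q) : Prop :=
  ∃ p, R.nbr (R.nbr v i) p = v ∧ R.nbr (R.nbr v i) (p + 1) = R.nbr v (i - 1) ∧
    R.nbr (R.nbr v i) (p - 1) = R.nbr v (i + 1)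

/-- The rotations at the ends of the edge from `v` to its `i`-th neighbour turn in opposite
senses. -/
def Reverses (v : V) (i : ZMod q) : Prop :=
  ∃ p, R.nbr (R.nbr v i) p = v ∧ R.nbr (R.nbr v i) (p + 1) = R.nbr v (i + 1) ∧
    R.nbr (R.nbr v i) (p - 1) = R.nbr v (i - 1)

variable [DecidableEq V]

/-- The `i`-th triangle at `v`. -/
def triangle (v : V) (i : ZMod q) : Finset V := {v, R.nbr v i, R.nbr v (i + 1)}

lemma exists_triangle_nbr (v : V) (i : ZMod q) :
    ∃ p, R.triangle (R.nbr v i) p = R.triangle v i := by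
  obtain ⟨p, hp, h | h⟩ := R.exists_edge v i
  · refine ⟨p - 1, ?_⟩
    rw [triangle, triangle, sub_add_cancel, hp, h.2]
    ext; simp; tauto
  · refine ⟨p, ?_⟩
    rw [triangle, triangle, hp, h.1]
    ext; simp; tauto

lemma exists_triangle_nbr_add_one (v : V) (i : ZMod q) :
    ∃ p, R.triangle (R.nbr v (i + 1)) p = R.triangle v i := by
  obtain ⟨p, hp, h | h⟩ := R.exists_edge v (i + 1)
  · refine ⟨p, ?_⟩
    rw [triangle, triangle, hp, h.1, add_sub_cancel_right]
    ext; simp; tauto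
  · refine ⟨p - 1, ?_⟩
    rw [triangle, triangle, sub_add_cancel, hp, h.2, add_sub_cancel_right]
    ext; simp; tauto

/-- A triangle of the system occurs among the triangles at each of its vertices. -/
lemma exists_triangle_eq {u v : V} {i : ZMod q} (hu : u ∈ R.triangle v i) :
    ∃ p, R.triangle u p = R.triangle v i := by
  simp only [triangle, Finset.mem_insert, Finset.mem_singleton] at hu
  obtain rfl | rfl | rfl := hu
  · exact ⟨i, rfl⟩
  · exact R.exists_triangle_nbr v i
  · exact R.exists_triangle_nbr_add_one v i

/-- The simplicial complex whose facets are the triangles of a rotation system. -/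
def complex : AbstractSimplicialComplex V where
  faces := {s | s.Nonempty ∧ ∃ v i, s ⊆ R.triangle v i}
  isRelLowerSet_faces := fun _ ⟨hs, v, i, h⟩ => ⟨hs, fun _ ht hne => ⟨hne, v, i, ht.trans h⟩⟩
  singleton_mem v := ⟨Finset.singleton_nonempty v, v, 0, by simp [triangle]⟩

lemma triangle_mem (v : V) (i : ZMod q) : R.triangle v i ∈ R.complex.faces :=
  ⟨⟨v, by simp [triangle]⟩, v, i, subset_rfl⟩

lemma subset_triangle_of_mem {s : Finset V} (hs : s ∈ R.complex.faces) {v : V} (hv : v ∈ s) :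
    ∃ i, s ⊆ R.triangle v i := by
  obtain ⟨-, u, i, h⟩ := hs
  obtain ⟨p, hp⟩ := R.exists_triangle_eq (h hv)
  exact ⟨p, hp ▸ h⟩

lemma hasCyclicLink (v : V) : R.complex.HasCyclicLink v (R.nbr v) where
  injective := R.nbr_injective v
  ne := R.nbr_ne v
  triangle_mem := R.triangle_mem v
  subset_triangle _ hs hv := R.subset_triangle_of_mem hs hv

lemma pair_mem_iff {v w : V} (h : w ≠ v) : {v, w} ∈ R.complex.faces ↔ ∃ i, R.nbr v i = w := by
  constructor
  · intro hs
    obtain ⟨i, hi⟩ := R.subset_triangle_of_mem hs (Finset.mem_insert_self v _)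
    have hw : w ∈ R.triangle v i := hi (by simp)
    simp only [triangle, Finset.mem_insert, Finset.mem_singleton, h, false_or] at hw
    obtain rfl | rfl := hw
    exacts [⟨i, rfl⟩, ⟨i + 1, rfl⟩]
  · rintro ⟨i, rfl⟩
    refine ⟨by simp, v, i, fun u hu => ?_⟩
    simp only [triangle, Finset.mem_insert, Finset.mem_singleton] at hu ⊢
    tauto

lemma isEquivelar : R.complex.IsEquivelar q := by
  intro v
  have : {w | w ≠ v ∧ {v, w} ∈ R.complex.faces} = Set.range (R.nbr v) := by
    ext w
    constructor
    · rintro ⟨h, hw⟩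
      exact (R.pair_mem_iff h).1 hw
    · rintro ⟨i, rfl⟩
      exact ⟨R.nbr_ne v i, (R.pair_mem_iff (R.nbr_ne v i)).2 ⟨i, rfl⟩⟩
  rw [AbstractSimplicialComplex.vertexDegree, this, ← Set.image_univ,
    Set.ncard_image_of_injective _ (R.nbr_injective v), Set.ncard_univ, Nat.card_zmod]

/-! ### The Euler characteristic -/

lemma card_triangle (hq : 5 ≤ q) (v : V) (i : ZMod q) : (R.triangle v i).card = 3 := by
  have : Fact (1 < q) := ⟨by omega⟩
  refine Finset.card_eq_three.2 ⟨_, _, _, (R.nbr_ne v i).symm, (R.nbr_ne v (i + 1)).symm, ?_, rfl⟩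
  intro h
  simpa using R.nbr_injective v h

lemma triangle_injective (hq : 5 ≤ q) (v : V) : Function.Injective (R.triangle v) := by
  have : Fact (1 < q) := ⟨by omega⟩
  intro i j hij
  have h2 := zmod_two_ne_zero hq
  have mem {a : ZMod q} {b : ZMod q} (h : R.nbr v a ∈ R.triangle v b) : a = b ∨ a = b + 1 := by
    simpa [triangle, R.nbr_ne, (R.nbr_injective v).eq_iff] using h
  have h1 := mem (a := i) (b := j) (hij ▸ by simp [triangle])
  have h3 := mem (a := j) (b := i) (hij ▸ by simp [triangle])
  rcases h1 with h1 | h1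
  · exact h1
  · rcases h3 with h3 | h3
    · exact h3.symm
    · exact absurd (by linear_combination -h1 - h3 : (2 : ZMod q) = 0) h2

/-- Double counting of the incidences of vertices with the faces of a fixed dimension. -/
lemma mul_fNumber [Fintype V] (K : AbstractSimplicialComplex V) (d m : ℕ)
    (h : ∀ v, {s : Finset V | (s ∈ K.faces ∧ s.card = d + 1) ∧ v ∈ s}.ncard = m) :
    (d + 1) * K.fNumber d = Fintype.card V * m := by
  classical
  have hB (v : V) : (Finset.univ.filter fun s : Finset V => s ∈ K.faces ∧ s.card = d + 1).filter
      (fun s => v ∈ s) = {s : Finset V | (s ∈ K.faces ∧ s.card = d + 1) ∧ v ∈ s}.toFinset := by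
    ext; simp
  have := Finset.sum_card (B := Finset.univ.filter fun s : Finset V => s ∈ K.faces ∧ s.card = d + 1)
    (n := m) (fun v => by rw [hB, ← Set.ncard_eq_toFinset_card', h v])
  rw [Finset.sum_congr rfl fun s hs => (Finset.mem_filter.1 hs).2.2, Finset.sum_const,
    smul_eq_mul] at this
  rw [← this, mul_comm, AbstractSimplicialComplex.fNumber, Set.ncard_eq_toFinset_card']
  congr 2
  ext; simp

lemma two_mul_fNumber_one [Fintype V] :
    2 * R.complex.fNumber 1 = Fintype.card V * q := by
  refine mul_fNumber R.complex 1 q fun v => ?_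
  have : {s : Finset V | (s ∈ R.complex.faces ∧ s.card = 1 + 1) ∧ v ∈ s} =
      Set.range fun i => ({v, R.nbr v i} : Finset V) := by
    ext s
    constructor
    · rintro ⟨⟨hs, hc⟩, hv⟩
      obtain ⟨w, hw⟩ := Finset.card_eq_one.1 (by rw [Finset.card_erase_of_mem hv, hc] :
        (s.erase v).card = 1)
      have hwv : w ≠ v := (Finset.mem_erase.1 (hw ▸ Finset.mem_singleton_self w)).1
      obtain rfl : {v, w} = s := by rw [← Finset.insert_erase hv, hw]
      obtain ⟨i, rfl⟩ := (R.pair_mem_iff hwv).1 hs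
      exact ⟨i, rfl⟩
    · rintro ⟨i, rfl⟩
      exact ⟨⟨(R.pair_mem_iff (R.nbr_ne v i)).2 ⟨i, rfl⟩,
        Finset.card_pair (R.nbr_ne v i).symm⟩, by simp⟩
  have hinj : Function.Injective fun i => ({v, R.nbr v i} : Finset V) := by
    intro i j hij
    have : R.nbr v i ∈ ({v, R.nbr v j} : Finset V) :=
      Finset.ext_iff.1 hij (R.nbr v i) |>.1 (by simp)
    simpa [R.nbr_ne, (R.nbr_injective v).eq_iff] using this
  rw [this, ← Set.image_univ, Set.ncard_image_of_injective _ hinj, Set.ncard_univ, Nat.card_zmod]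

lemma three_mul_fNumber_two [Fintype V] (hq : 5 ≤ q) :
    3 * R.complex.fNumber 2 = Fintype.card V * q := by
  refine mul_fNumber R.complex 2 q fun v => ?_
  have : {s : Finset V | (s ∈ R.complex.faces ∧ s.card = 2 + 1) ∧ v ∈ s} =
      Set.range (R.triangle v) := by
    ext s
    constructor
    · rintro ⟨⟨hs, hc⟩, hv⟩
      obtain ⟨i, hi⟩ := R.subset_triangle_of_mem hs hv
      exact ⟨i, (Finset.eq_of_subset_of_card_le hi (by rw [R.card_triangle hq, hc])).symm⟩
    · rintro ⟨i, rfl⟩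
      exact ⟨⟨R.triangle_mem v i, R.card_triangle hq v i⟩, by simp [triangle]⟩
  rw [this, ← Set.image_univ, Set.ncard_image_of_injective _ (R.triangle_injective hq v),
    Set.ncard_univ, Nat.card_zmod]

lemma fNumber_zero [Fintype V] (K : AbstractSimplicialComplex V) :
    K.fNumber 0 = Fintype.card V := by
  have := mul_fNumber K 0 1 fun v => by
    rw [Set.ncard_eq_one]
    refine ⟨{v}, Set.ext fun s => ⟨?_, ?_⟩⟩
    · rintro ⟨⟨-, hc⟩, hv⟩
      obtain ⟨w, rfl⟩ := Finset.card_eq_one.1 hc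
      simp_all
    · rintro rfl
      exact ⟨⟨K.singleton_mem v, rfl⟩, by simp⟩
  omega

lemma fNumber_eq_zero (hq : 5 ≤ q) {d : ℕ} (hd : 3 ≤ d) : R.complex.fNumber d = 0 := by
  have : {s : Finset V | s ∈ R.complex.faces ∧ s.card = d + 1} = ∅ := by
    refine Set.eq_empty_iff_forall_notMem.2 ?_
    rintro s ⟨⟨-, v, i, h⟩, hc⟩
    have := Finset.card_le_card h
    rw [R.card_triangle hq] at this
    omega
  rw [AbstractSimplicialComplex.fNumber, this, Set.ncard_empty]

lemma six_mul_eulerChar [Fintype V] (hq : 5 ≤ q) (hV : 3 ≤ Fintype.card V) :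
    6 * R.complex.eulerChar = Fintype.card V * (6 - q : ℤ) := by
  have h : R.complex.eulerChar =
      ∑ i ∈ Finset.range 3, (-1) ^ i * (R.complex.fNumber i : ℤ) := by
    refine (Finset.sum_subset (by simpa using hV) fun i _ hi => ?_).symm
    rw [R.fNumber_eq_zero hq (by simpa using hi)]
    simp
  have h1 := R.two_mul_fNumber_one
  have h2 := R.three_mul_fNumber_two hq
  zify at h1 h2
  rw [h]
  simp only [Finset.sum_range_succ, Finset.sum_range_zero, fNumber_zero]
  linear_combination (-3) * h1 + 2 * h2

/-! ### Orientability -/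

/-- A rotation system whose rotations all turn in the same sense defines an orientable surface: a
triangle is oriented as the rotations turn. -/
lemma isOrientable (hq : 5 ≤ q) (h : ∀ v i, R.Preserves v i) : R.complex.IsOrientable := by
  have : Fact (1 < q) := ⟨by omega⟩
  have h2 := zmod_two_ne_zero hq
  have hrot (a b c : V) (habc : ∃ i, R.nbr a i = b ∧ R.nbr a (i + 1) = c) :
      ∃ i, R.nbr b i = c ∧ R.nbr b (i + 1) = a := by
    obtain ⟨i, rfl, rfl⟩ := habc
    obtain ⟨p, hp, -, h2⟩ := h a i
    exact ⟨p - 1, h2, by rw [sub_add_cancel, hp]⟩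
  refine ⟨fun a b c => ∃ i, R.nbr a i = b ∧ R.nbr a (i + 1) = c, hrot, ?_, ?_, ?_⟩
  · rintro a b c ⟨i, rfl, rfl⟩
    refine ⟨(R.nbr_ne a i).symm, fun e => ?_, (R.nbr_ne a _).symm, R.triangle_mem a i⟩
    simpa using R.nbr_injective a e
  · intro a b c hab hbc hac hs
    constructor
    · rintro ⟨i, rfl, rfl⟩ h'
      obtain ⟨j, hj, hj'⟩ := hrot _ _ _ h'
      have e1 := R.nbr_injective a hj
      have e2 := R.nbr_injective a hj'
      exact h2 (by rw [e1] at e2; linear_combination e2)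
    · intro h'
      obtain ⟨i, hi⟩ := R.subset_triangle_of_mem hs (Finset.mem_insert_self a _)
      have hb : b ∈ R.triangle a i := hi (by simp)
      have hc : c ∈ R.triangle a i := hi (by simp)
      simp only [triangle, Finset.mem_insert, Finset.mem_singleton, hab.symm, hac.symm,
        false_or] at hb hc
      rcases hb with rfl | rfl <;> rcases hc with rfl | rfl
      · exact absurd rfl hbc
      · exact ⟨i, rfl, rfl⟩
      · exact absurd (hrot _ _ _ (hrot _ _ _ ⟨i, rfl, rfl⟩)) h'
      · exact absurd rfl hbc
  · rintro a b c d ⟨i, rfl, rfl⟩ ⟨j, hj, rfl⟩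
    rw [R.nbr_injective a hj]

/-- If the rotations at adjacent vertices along a connected set of edges turn in the same sense,
but in opposite senses along a further edge, then the surface is not orientable: an orientation
agrees with the rotations either at all vertices or at none. -/
lemma not_isOrientable (hq : 5 ≤ q)
    (hconn : ∀ u v, Relation.ReflTransGen (fun a b => ∃ i, R.Preserves a i ∧ R.nbr a i = b) u v)
    {v : V} {i : ZMod q} (hrev : R.Reverses v i) : ¬ R.complex.IsOrientable := by
  have : Fact (1 < q) := ⟨by omega⟩
  have h2 := zmod_two_ne_zero hq
  rintro ⟨O, hcyc, -, hex, hcoh⟩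
  have hswap (a : V) (j : ZMod q) :
      O a (R.nbr a j) (R.nbr a (j + 1)) ↔ ¬ O (R.nbr a j) a (R.nbr a (j + 1)) :=
    hex _ _ _ (R.nbr_ne a j).symm
      (fun e => by simpa using R.nbr_injective a e) (R.nbr_ne a _).symm (R.triangle_mem a j)
  -- The sense of rotation around a vertex is constant.
  have hstep (a : V) (j : ZMod q) : O a (R.nbr a j) (R.nbr a (j + 1)) ↔
      O a (R.nbr a (j + 1)) (R.nbr a (j + 1 + 1)) := by
    have hne : R.nbr a j ≠ R.nbr a (j + 1 + 1) := fun e =>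
      h2 (by linear_combination -(R.nbr_injective a e))
    constructor
    · intro h
      by_contra h'
      rw [hswap, not_not] at h'
      exact hne (hcoh _ _ _ _ (hcyc _ _ _ (hcyc _ _ _ h)) h')
    · intro h
      by_contra h'
      rw [hswap, not_not] at h'
      exact hne (hcoh _ _ _ _ (hcyc _ _ _ h') h)
  have hconst (a : V) (j : ZMod q) : O a (R.nbr a j) (R.nbr a (j + 1)) ↔
      O a (R.nbr a 0) (R.nbr a (0 + 1)) := by
    obtain ⟨m, rfl⟩ := ZMod.intCast_surjective j
    induction m using Int.induction_on with
    | zero => simp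
    | succ m ih => rw [← ih, hstep a (m : ℤ)]; push_cast; rfl
    | pred m ih =>
      rw [← ih, hstep a ((-(m : ℤ) - 1 : ℤ) : ZMod q)]
      push_cast
      rw [sub_add_cancel]
  have hpres (a : V) (j : ZMod q) (h : R.Preserves a j) :
      O a (R.nbr a 0) (R.nbr a (0 + 1)) ↔
        O (R.nbr a j) (R.nbr (R.nbr a j) 0) (R.nbr (R.nbr a j) (0 + 1)) := by
    obtain ⟨p, hp, hp1, -⟩ := h
    rw [← hconst a (j - 1), ← hconst (R.nbr a j) p, hp, hp1, sub_add_cancel]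
    exact ⟨fun h => hcyc _ _ _ (hcyc _ _ _ h), fun h => hcyc _ _ _ h⟩
  have hall (a b : V) : O a (R.nbr a 0) (R.nbr a (0 + 1)) ↔ O b (R.nbr b 0) (R.nbr b (0 + 1)) := by
    induction hconn a b with
    | refl => rfl
    | tail _ hbc ih =>
      obtain ⟨j, hj, rfl⟩ := hbc
      exact ih.trans (hpres _ _ hj)
  obtain ⟨p, hp, hp1, -⟩ := hrev
  have h3 := hswap v i
  have h4 := hconst (R.nbr v i) p
  rw [hp, hp1] at h4
  rw [hconst v i, h4, hall (R.nbr v i) v] at h3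
  exact iff_not_self h3

lemma isSurfaceTriangulation [Fintype V] [Nonempty V] (hq : 5 ≤ q)
    (hconn : ∀ u v, Relation.ReflTransGen (fun a b => ∃ i, R.nbr a i = b) u v) :
    R.complex.IsSurfaceTriangulation := by
  refine AbstractSimplicialComplex.isSurfaceTriangulation_of_hasCyclicLink hq R.hasCyclicLink
    fun u v => Relation.ReflTransGen.mono ?_ u v (hconn u v)
  rintro a _ ⟨i, rfl⟩
  exact (R.pair_mem_iff (R.nbr_ne a i)).2 ⟨i, rfl⟩

end RotationSystem

/-! ### Rotation systems with a cyclic symmetry -/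

lemma zmod_val_add_one {q : ℕ} [NeZero q] (i : ZMod q) : (i + 1).val = (i.val + 1) % q := by
  rw [← ZMod.val_natCast, Nat.cast_add, ZMod.natCast_zmod_val, Nat.cast_one]

lemma zmod_val_sub_one {q : ℕ} [NeZero q] (i : ZMod q) : (i - 1).val = (i.val + (q - 1)) % q := by
  rw [← ZMod.val_natCast, Nat.cast_add, ZMod.natCast_zmod_val,
    Nat.cast_sub (Nat.pos_of_ne_zero (NeZero.ne q))]
  simp [sub_eq_add_neg]

/-- The table `f` of offsets describes the neighbours `v + f (v % k) j` of each vertex `v` modulo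
`n`. At the edge from `v` to its `j`-th neighbour `w`, where `v % k = i`, the rotations at `v` and
`w` turn in the same sense: `v` is the `p`-th neighbour of `w`, and the neighbours of `w` next to it
are the neighbours of `v` next to `w` in opposite order. All vertices are given by their differences
from `v`, so that the condition depends on `i` only. -/
def TablePreserves (n q k : ℕ) (f : ℕ → ℕ → ℕ) (i j : ℕ) : Prop :=
  ∃ p < q, f i j + f ((i + f i j) % k) p = n ∧
    (f i j + f ((i + f i j) % k) ((p + 1) % q)) % n = f i ((j + (q - 1)) % q) ∧
    (f i j + f ((i + f i j) % k) ((p + (q - 1)) % q)) % n = f i ((j + 1) % q)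

/-- The analogue of `TablePreserves` for rotations which turn in opposite senses. -/
def TableReverses (n q k : ℕ) (f : ℕ → ℕ → ℕ) (i j : ℕ) : Prop :=
  ∃ p < q, f i j + f ((i + f i j) % k) p = n ∧
    (f i j + f ((i + f i j) % k) ((p + 1) % q)) % n = f i ((j + 1) % q) ∧
    (f i j + f ((i + f i j) % k) ((p + (q - 1)) % q)) % n = f i ((j + (q - 1)) % q)

/-- A table of offsets which describes a rotation system on the vertices `0, …, n - 1` that is
invariant under the translation `v ↦ v + k` modulo `n`, and such that the first neighbour of each
vertex `v` is `v + 1`. -/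
structure IsOffsetTable (n q k : ℕ) (f : ℕ → ℕ → ℕ) : Prop where
  n_pos : 0 < n
  k_pos : 0 < k
  dvd : k ∣ n
  first : ∀ i < k, f i 0 = 1
  pos : ∀ i < k, ∀ j < q, 0 < f i j
  ne : ∀ i < k, ∀ j < q, ∀ j' < j, f i j ≠ f i j'
  edge : ∀ i < k, ∀ j < q, TablePreserves n q k f i j ∨ TableReverses n q k f i j

/-- The `i`-th neighbour of `v` in the rotation system described by a table of offsets. -/
def tableNbr {n q : ℕ} (k : ℕ) (f : ℕ → ℕ → ℕ) (v : Fin n) (i : ZMod q) : Fin n :=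
  ⟨(v + f (v % k) i.val) % n, Nat.mod_lt _ v.pos⟩

lemma val_tableNbr {n q : ℕ} (k : ℕ) (f : ℕ → ℕ → ℕ) (v : Fin n) (i : ZMod q) :
    (tableNbr k f v i : ℕ) = (v + f (v % k) i.val) % n := rfl

namespace IsOffsetTable

variable {n q k : ℕ} {f : ℕ → ℕ → ℕ}

lemma lt (h : IsOffsetTable n q k f) {i j : ℕ} (hi : i < k) (hj : j < q) : f i j < n := by
  obtain ⟨p, hp, hp', -⟩ | ⟨p, hp, hp', -⟩ := h.edge i hi j hj <;>
  · have := h.pos ((i + f i j) % k) (Nat.mod_lt _ h.k_pos) p hp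
    omega

lemma val_tableNbr_tableNbr (h : IsOffsetTable n q k f) (v : Fin n) (i p : ZMod q) :
    (tableNbr k f (tableNbr k f v i) p : ℕ) =
      (v + (f (v % k) i.val + f ((v % k + f (v % k) i.val) % k) p.val)) % n := by
  simp only [val_tableNbr, Nat.mod_mod_of_dvd _ h.dvd, Nat.mod_add_mod, add_assoc]

lemma tableNbr_tableNbr_eq_self (h : IsOffsetTable n q k f) {v : Fin n} {i p : ZMod q}
    (hp : f (v % k) i.val + f ((v % k + f (v % k) i.val) % k) p.val = n) :
    tableNbr k f (tableNbr k f v i) p = v := by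
  ext
  rw [h.val_tableNbr_tableNbr, hp, Nat.add_mod_right, Nat.mod_eq_of_lt v.2]

lemma tableNbr_tableNbr_eq (h : IsOffsetTable n q k f) {v : Fin n} {i p j : ZMod q}
    (hp : (f (v % k) i.val + f ((v % k + f (v % k) i.val) % k) p.val) % n = f (v % k) j.val) :
    tableNbr k f (tableNbr k f v i) p = tableNbr k f v j := by
  ext
  rw [h.val_tableNbr_tableNbr, val_tableNbr, ← hp, Nat.add_mod_mod]

lemma exists_of_tablePreserves [NeZero q] (h : IsOffsetTable n q k f) {v : Fin n} {i : ZMod q}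
    (hv : TablePreserves n q k f (v % k) i.val) :
    ∃ p : ZMod q, tableNbr k f (tableNbr k f v i) p = v ∧
      tableNbr k f (tableNbr k f v i) (p + 1) = tableNbr k f v (i - 1) ∧
      tableNbr k f (tableNbr k f v i) (p - 1) = tableNbr k f v (i + 1) := by
  obtain ⟨p, hp, h1, h2, h3⟩ := hv
  have hval : (p : ZMod q).val = p := ZMod.val_cast_of_lt hp
  refine ⟨p, h.tableNbr_tableNbr_eq_self ?_, h.tableNbr_tableNbr_eq ?_,
    h.tableNbr_tableNbr_eq ?_⟩ <;>
  simpa only [zmod_val_add_one, zmod_val_sub_one, hval]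

lemma exists_of_tableReverses [NeZero q] (h : IsOffsetTable n q k f) {v : Fin n} {i : ZMod q}
    (hv : TableReverses n q k f (v % k) i.val) :
    ∃ p : ZMod q, tableNbr k f (tableNbr k f v i) p = v ∧
      tableNbr k f (tableNbr k f v i) (p + 1) = tableNbr k f v (i + 1) ∧
      tableNbr k f (tableNbr k f v i) (p - 1) = tableNbr k f v (i - 1) := by
  obtain ⟨p, hp, h1, h2, h3⟩ := hv
  have hval : (p : ZMod q).val = p := ZMod.val_cast_of_lt hp
  refine ⟨p, h.tableNbr_tableNbr_eq_self ?_, h.tableNbr_tableNbr_eq ?_,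
    h.tableNbr_tableNbr_eq ?_⟩ <;>
  simpa only [zmod_val_add_one, zmod_val_sub_one, hval]

/-- The rotation system described by a table of offsets. -/
def rotationSystem [NeZero q] (h : IsOffsetTable n q k f) : RotationSystem (Fin n) q where
  nbr := tableNbr k f
  nbr_injective v i j hij := by
    have hk : (v : ℕ) % k < k := Nat.mod_lt _ h.k_pos
    have h1 : f (v % k) i.val ≡ f (v % k) j.val [MOD n] :=
      Nat.ModEq.add_left_cancel' (v : ℕ) (congrArg Fin.val hij)
    have h2 := h1.eq_of_lt_of_lt (h.lt hk (ZMod.val_lt i)) (h.lt hk (ZMod.val_lt j))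
    apply ZMod.val_injective q
    rcases lt_trichotomy i.val j.val with hlt | heq | hlt
    · exact absurd h2.symm (h.ne _ hk _ (ZMod.val_lt j) _ hlt)
    · exact heq
    · exact absurd h2 (h.ne _ hk _ (ZMod.val_lt i) _ hlt)
  nbr_ne v i hi := by
    have hk : (v : ℕ) % k < k := Nat.mod_lt _ h.k_pos
    have h1 : (v : ℕ) + f (v % k) i.val ≡ v + 0 [MOD n] :=
      (congrArg Fin.val hi).trans (Nat.mod_eq_of_lt v.2).symm
    have h2 := (Nat.ModEq.add_left_cancel' (v : ℕ) h1).eq_of_lt_of_lt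
      (h.lt hk (ZMod.val_lt i)) h.n_pos
    exact (h.pos _ hk _ (ZMod.val_lt i)).ne' h2
  exists_edge v i := by
    rcases h.edge _ (Nat.mod_lt v h.k_pos) _ (ZMod.val_lt i) with hv | hv
    · obtain ⟨p, h0, h1⟩ := h.exists_of_tablePreserves hv
      exact ⟨p, h0, Or.inl h1⟩
    · obtain ⟨p, h0, h1⟩ := h.exists_of_tableReverses hv
      exact ⟨p, h0, Or.inr h1⟩

/-- The edges from `v` to `v + 1` connect all vertices. -/
lemma reflTransGen (h : IsOffsetTable n q k f) {r : Fin n → Fin n → Prop}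
    (hr : ∀ v, r v (tableNbr k f v (0 : ZMod q))) (u v : Fin n) : Relation.ReflTransGen r u v := by
  have hadd (m : ℕ) :
      Relation.ReflTransGen r u ⟨(u + m) % n, Nat.mod_lt _ h.n_pos⟩ := by
    induction m with
    | zero =>
      have : (⟨(u + 0) % n, Nat.mod_lt _ h.n_pos⟩ : Fin n) = u :=
        Fin.ext (Nat.mod_eq_of_lt u.2)
      rw [this]
    | succ m ih =>
      refine ih.tail ?_
      convert hr _
      simp [tableNbr, h.first _ (Nat.mod_lt _ h.k_pos), add_assoc]
  convert hadd (n - u + v)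
  have h1 : (u : ℕ) + (n - u + v) = n + v := by omega
  simp [h1, Nat.mod_eq_of_lt v.2]

theorem exists_orientable (h : IsOffsetTable n q k f) (hq : 5 ≤ q) (hn : 3 ≤ n)
    (hpres : ∀ i < k, ∀ j < q, TablePreserves n q k f i j) :
    ∃ K : AbstractSimplicialComplex (Fin n), K.IsSurfaceTriangulation ∧
      6 * K.eulerChar = n * (6 - q : ℤ) ∧ K.IsOrientable ∧ K.IsEquivelar q := by
  have : NeZero q := ⟨by omega⟩
  have : Nonempty (Fin n) := ⟨⟨0, h.n_pos⟩⟩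
  refine ⟨h.rotationSystem.complex, h.rotationSystem.isSurfaceTriangulation hq
    (h.reflTransGen fun v => ⟨0, rfl⟩), ?_, h.rotationSystem.isOrientable hq fun v i =>
      h.exists_of_tablePreserves (hpres _ (Nat.mod_lt v h.k_pos) _ (ZMod.val_lt i)),
    h.rotationSystem.isEquivelar⟩
  simpa using h.rotationSystem.six_mul_eulerChar hq (by simpa using hn)

theorem exists_nonorientable (h : IsOffsetTable n q k f) (hq : 5 ≤ q) (hn : 3 ≤ n)
    (hpres : ∀ i < k, TablePreserves n q k f i 0) {i j : ℕ} (hi : i < k) (hj : j < q)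
    (hrev : TableReverses n q k f i j) :
    ∃ K : AbstractSimplicialComplex (Fin n), K.IsSurfaceTriangulation ∧
      6 * K.eulerChar = n * (6 - q : ℤ) ∧ ¬ K.IsOrientable ∧ K.IsEquivelar q := by
  have : NeZero q := ⟨by omega⟩
  have : Nonempty (Fin n) := ⟨⟨0, h.n_pos⟩⟩
  refine ⟨h.rotationSystem.complex, h.rotationSystem.isSurfaceTriangulation hq
    (h.reflTransGen fun v => ⟨0, rfl⟩), ?_, ?_, h.rotationSystem.isEquivelar⟩
  · simpa using h.rotationSystem.six_mul_eulerChar hq (by simpa using hn)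
  · refine h.rotationSystem.not_isOrientable hq (h.reflTransGen fun v => ⟨0,
      h.exists_of_tablePreserves (by simpa using hpres _ (Nat.mod_lt v h.k_pos)), rfl⟩)
      (v := ⟨i, hi.trans_le (Nat.le_of_dvd h.n_pos h.dvd)⟩) (i := (j : ZMod q))
      (h.exists_of_tableReverses ?_)
    simpa [Nat.mod_eq_of_lt hi, ZMod.val_cast_of_lt hj] using hrev

end IsOffsetTable

/-! ### Numerical codes of tables of offsets -/

/-- All numbers below a bound satisfy a Boolean predicate. Plain recursion keeps the evaluation by
the kernel cheap. -/
def allBelow (p : ℕ → Bool) : ℕ → Bool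
  | 0 => true
  | m + 1 => p m && allBelow p m

/-- Some number below a bound satisfies a Boolean predicate. -/
def anyBelow (p : ℕ → Bool) : ℕ → Bool
  | 0 => false
  | m + 1 => p m || anyBelow p m

lemma allBelow_eq_true {p : ℕ → Bool} {m : ℕ} : allBelow p m = true ↔ ∀ i < m, p i = true := by
  induction m with
  | zero => simp [allBelow]
  | succ m ih => rw [allBelow, Bool.and_eq_true, ih, Nat.forall_lt_succ_right, and_comm]

lemma anyBelow_eq_true {p : ℕ → Bool} {m : ℕ} : anyBelow p m = true ↔ ∃ i < m, p i = true := by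
  induction m with
  | zero => simp [anyBelow]
  | succ m ih => rw [anyBelow, Bool.or_eq_true, ih, Nat.exists_lt_succ_right, or_comm]

/-- The `j`-th digit of `r` in base `100`, counted from the least significant one. -/
def digit (r j : ℕ) : ℕ := r / 100 ^ j % 100

/-- The `i`-th block of `q` digits of `c` in base `100`. -/
def digitRow (q c i : ℕ) : ℕ := c / 100 ^ (q * i) % 100 ^ q

/-- The table of offsets with the rows `digitRow q c i`. -/
def codeTable (q c i j : ℕ) : ℕ := digit (digitRow q c i) j

/-- The common form of `TablePreserves` and `TableReverses` for an entry of the row `r` and the row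
`r'` of the corresponding neighbour; `a` and `b` are the positions in `r` to which those after and
before `p` in `r'` correspond. -/
def checkEdge (n q r r' j a b : ℕ) : Bool :=
  anyBelow (fun p => Nat.beq (digit r j + digit r' p) n &&
    (Nat.beq ((digit r j + digit r' ((p + 1) % q)) % n) (digit r a) &&
      Nat.beq ((digit r j + digit r' ((p + (q - 1)) % q)) % n) (digit r b))) q

/-- A test for `TablePreserves`. -/
def checkPreserves (n q k c i j : ℕ) : Bool :=
  checkEdge n q (digitRow q c i) (digitRow q c ((i + codeTable q c i j) % k)) j
    ((j + (q - 1)) % q) ((j + 1) % q)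

/-- A test for `TableReverses`. -/
def checkReverses (n q k c i j : ℕ) : Bool :=
  checkEdge n q (digitRow q c i) (digitRow q c ((i + codeTable q c i j) % k)) j
    ((j + 1) % q) ((j + (q - 1)) % q)

/-- A test of the conditions on the single rows in `IsOffsetTable`. -/
def checkRow (q r : ℕ) : Bool :=
  Nat.beq (digit r 0) 1 && allBelow (fun j => Nat.ble 1 (digit r j) &&
    allBelow (fun j' => !Nat.beq (digit r j) (digit r j')) j) q

/-- A test for offset tables of orientable surfaces. -/
def checkOrientable (n q k c : ℕ) : Bool :=
  (Nat.ble 1 n && Nat.ble 1 k && Nat.beq (n % k) 0) &&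
    allBelow (fun i => checkRow q (digitRow q c i) &&
      allBelow (fun j => checkPreserves n q k c i j) q) k

/-- A test for offset tables of non-orientable surfaces. -/
def checkNonorientable (n q k c : ℕ) : Bool :=
  (Nat.ble 1 n && Nat.ble 1 k && Nat.beq (n % k) 0) &&
    allBelow (fun i => checkRow q (digitRow q c i) && (checkPreserves n q k c i 0 &&
      allBelow (fun j => checkPreserves n q k c i j || checkReverses n q k c i j) q)) k &&
    anyBelow (fun i => anyBelow (fun j => checkReverses n q k c i j) q) k

lemma tablePreserves_of_check {n q k c i j : ℕ} (h : checkPreserves n q k c i j = true) :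
    TablePreserves n q k (codeTable q c) i j := by
  simpa only [checkPreserves, checkEdge, anyBelow_eq_true, Bool.and_eq_true, Nat.beq_eq,
    TablePreserves, codeTable] using h

lemma tableReverses_of_check {n q k c i j : ℕ} (h : checkReverses n q k c i j = true) :
    TableReverses n q k (codeTable q c) i j := by
  simpa only [checkReverses, checkEdge, anyBelow_eq_true, Bool.and_eq_true, Nat.beq_eq,
    TableReverses, codeTable] using h

lemma isOffsetTable_of_check {n q k c : ℕ}
    (h : (Nat.ble 1 n && Nat.ble 1 k && Nat.beq (n % k) 0) = true)
    (hrow : ∀ i < k, checkRow q (digitRow q c i) = true)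
    (hedge : ∀ i < k, ∀ j < q,
      checkPreserves n q k c i j = true ∨ checkReverses n q k c i j = true) :
    IsOffsetTable n q k (codeTable q c) := by
  simp only [Bool.and_eq_true, Nat.ble_eq, Nat.beq_eq] at h
  simp only [checkRow, Bool.and_eq_true, allBelow_eq_true, Nat.beq_eq, Nat.ble_eq,
    Bool.not_eq_true'] at hrow
  exact
    { n_pos := h.1.1
      k_pos := h.1.2
      dvd := Nat.dvd_of_mod_eq_zero h.2
      first := fun i hi => (hrow i hi).1
      pos := fun i hi j hj => ((hrow i hi).2 j hj).1
      ne := fun i hi j hj j' hj' =>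
        Nat.ne_of_beq_eq_false (((hrow i hi).2 j hj).2 j' hj')
      edge := fun i hi j hj =>
        (hedge i hi j hj).imp tablePreserves_of_check tableReverses_of_check }

lemma exists_orientable_of_check {n q k c : ℕ} (hq : 5 ≤ q) (hn : 3 ≤ n)
    (h : checkOrientable n q k c = true) :
    ∃ K : AbstractSimplicialComplex (Fin n), K.IsSurfaceTriangulation ∧
      6 * K.eulerChar = n * (6 - q : ℤ) ∧ K.IsOrientable ∧ K.IsEquivelar q := by
  rw [checkOrientable, Bool.and_eq_true, allBelow_eq_true] at h
  simp only [Bool.and_eq_true (checkRow _ _), allBelow_eq_true] at h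
  exact (isOffsetTable_of_check h.1 (fun i hi => (h.2 i hi).1)
    fun i hi j hj => Or.inl ((h.2 i hi).2 j hj)).exists_orientable hq hn
      fun i hi j hj => tablePreserves_of_check ((h.2 i hi).2 j hj)

lemma exists_nonorientable_of_check {n q k c : ℕ} (hq : 5 ≤ q) (hn : 3 ≤ n)
    (h : checkNonorientable n q k c = true) :
    ∃ K : AbstractSimplicialComplex (Fin n), K.IsSurfaceTriangulation ∧
      6 * K.eulerChar = n * (6 - q : ℤ) ∧ ¬ K.IsOrientable ∧ K.IsEquivelar q := by
  rw [checkNonorientable, Bool.and_eq_true, Bool.and_eq_true (_ && _), allBelow_eq_true,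
    anyBelow_eq_true] at h
  simp only [Bool.and_eq_true (checkRow _ _), Bool.and_eq_true (checkPreserves _ _ _ _ _ _),
    allBelow_eq_true, anyBelow_eq_true, Bool.or_eq_true] at h
  obtain ⟨⟨h1, h2⟩, i, hi, j, hj, hrev⟩ := h
  exact (isOffsetTable_of_check h1 (fun i hi => (h2 i hi).1)
    fun i hi j hj => (h2 i hi).2.2 j hj).exists_nonorientable hq hn
      (fun i hi => tablePreserves_of_check (h2 i hi).2.1) hi hj (tableReverses_of_check hrev)

/-! ### The triangulations -/

/-- Codes of orientable triangulations: in an entry `(n, q, k, c)` the number `c` encodes the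
offsets of a `q`-equivelar triangulation with `n` vertices which is invariant under the translation
by `k`. In decimal notation, `c` lists the offsets with two digits each (a leading zero being
suppressed), to be read from right to left; the first `q` of them belong to the vertex `0`, the next
`q` to the vertex `1`, and so on. -/
def orientableCodes : List (ℕ × ℕ × ℕ × ℕ) :=
  [(12, 7, 2, 711060504080108040506110701),
   (12, 8, 3, 100308110509070109110203040706011009110605020301),
   (12, 9, 2, 30206080711041001080602110910040501),
   (12, 10, 2, 1108040302090507100102070408030510110901),
   (12, 11, 4, 610051104080702030901060911080403021007050110050304060702081109010902040306070511081001),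
   (14, 12, 2, 120409051008071306020301081005090412111302060701),
   (15, 10, 3, 30210141213041105011110060514090408130106021404050711091001),
   (15, 14, 3, 90211121005080607041303140104061403100508091307121102010712081413091103100502060401),
   (16, 9, 2, 151406130710080201020810030906141501),
   (16, 12, 2, 150603140711131009020501020512111303141504090701),
   (16, 15, 2, 91211150413061403050208100701121009030708150602131114040501),
   (18, 8, 3, 30912061516170117120605091402010217161206041301),
   (18, 10, 2, 504161517020612140116041713141206020301),
   (18, 12, 2, 121711140305060704151301131603070605021511171201),
   (18, 14, 3, 160605151712100203081104070116080605110715171202031013011610080203140712111517061301),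
   (18, 16, 2, 514120602171516040908031113100103020710041709131406120815051601),
   (19, 18, 1, 41002140318061516110913121708050701),
   (20, 9, 2, 151410040319160601041014190506161701),
   (20, 12, 2, 181209170806191314020301070618171902081103121401),
   (20, 15, 2, 180515191009081117130702031201160314070405101513060917191101),
   (20, 18, 1, 170915021619070514181312030406110801),
   (21, 10, 3, 81404052019071710010613140411071516200117101412110720090201),
   (21, 14, 3, 50613100219141116170715200116171908180705100311042002010516020420191808141013110301),
   (21, 18, 1, 141706050213201511190307081004181601),
   (22, 12, 2, 201421070806191316020301151416030906201921020801),
   (22, 18, 1, 131720122107030518151402190409100801),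
   (23, 18, 1, 170409080310060720051913162214181501),
   (24, 7, 6, 182305060708011918231005060119052223121101232217191413010207051716230117230712190201),
   (24, 8, 3, 90807231516050108122019112316011213082304161701),
   (24, 9, 2, 50412162307082001171612042319200801),
   (24, 10, 2, 1016081823050614150119180816100923140601),
   (24, 11, 4, 1512031723160807050601182303142109101222170119182311212008161204011902142305060710131201),
   (24, 12, 2, 102107060511141509231801100313180923171415061901),
   (24, 13, 2, 2216080623121115171802030107222123020920081612041301),
   (24, 14, 3, 171005041415021311092307200110142319050411221302170708011522111317162319140709102001),
   (24, 15, 2, 40718231211032021090506131701190411172108072015120323161301),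
   (24, 16, 2, 2215071114170203102116080523190106050417081609072123181903132001),
   (24, 17, 4, 2204112306211912072018051509081601121317050218091422101119231608070120190813230405161106020312151817011412021622030921231506081019130501),
   (24, 18, 1, 161319152302200518222108090406110301),
   (24, 19, 2, 816170718232210050613150921191412020119050211171018092203121506160814072301),
   (24, 20, 3, 172209212014230312151307061119160205180115110203221420091006050708131921231804012209122105162317061008031513041811021901),
   (24, 21, 2, 142009061011231613041803171521080712190501121323040609022019142115110318220710051701),
   (24, 22, 2, 319230520061502100409181416082213112117070120031407040508162122110915191817101302230601),
   (24, 23, 4, 2118110908152022020419130614230512170310071601150416081220112213072114191023180509170302060111130910161204022220081807232114170603150519010816171106051007191820231502131409122103042201),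
   (25, 18, 1, 100222210924030517151612202308130401),
   (26, 12, 2, 251023021113161509242101021517060503132425201101),
   (26, 18, 1, 161215250805221011231817210314040901),
   (26, 24, 2, 220824031618140915192007231121120405021013062501072214031015120806170516191323212524180411200201),
   (27, 10, 3, 171112070822152610011606051419262110110120051318171626092201),
   (27, 14, 3, 222117160310260724131923060111092426100423151802031208012516172019040821260506141101),
   (27, 18, 1, 110624221617191821050210260825030901),
   (27, 22, 3, 21325140322171924111612052015041009082618010923152207120817030210051613112526241418190126172109190413101812141602150623112205082501),
   (27, 26, 3, 182116021726231404220624082025131219110309100507150118040326061713091012191608022205071525141121202324010424131105092119082025061502221726141218231016030701),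
   (28, 9, 2, 141519050403272401041327231409242501),
   (28, 12, 2, 260827192018132310020301090810150518262527022001),
   (28, 15, 2, 141523090819120521160727112001081327191405202109171623071201),
   (28, 18, 1, 222011131219080217092127152606071601),
   (28, 21, 2, 100708032320270625181922211217051609151401210309271322202505080214161123122606190701),
   (28, 24, 2, 161102231213072522042126091006031519172418270501191705071102122503102609242322152704131618210601),
   (28, 27, 2, 21416050423071815251017122627060911201303222108192401272311211624220812050917260420140602192510130318150701),
   (29, 18, 1, 122708112825100214040321191517182601),
   (30, 8, 3, 212922080910020122142928081523011516080722202901),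
   (30, 10, 2, 1020212928051507020122152010252308092901),
   (30, 12, 2, 232404091110062905262001070802212524222919280601),
   (30, 14, 3, 22319131814261225202917220121282926070910051312160418012921241104030908250517062701),
   (30, 16, 2, 1303242010041529280711260609020116042321271020171814151926122901),
   (30, 18, 1, 50824032526100906140429201622272101),
   (30, 20, 3, 90329051713140224212226270608152328250104261318162909230507222812252414212006011704082924092702251821150605031207161001),
   (30, 22, 2, 418150728232502091914262712160521291110200122150329191802070528162511201021230809141201),
   (30, 24, 2, 192612201702252927102216042328152408181406210501262516060818290405071112201409151303022410222801),
   (30, 26, 3, 260227212816101324030507090619081829231112202504170119120326232709081413172921180706040510221102252824011802232809052529162414121326211911172704070320062201),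
   (30, 28, 2, 2812232915111816221707192706140203201013050425082421260124261514020607190428122310201305090322172729250811181601),
   (31, 18, 1, 40618033014122529171613190227281501),
   (31, 30, 1, 71605092425121410180630021913232015222717292808210426110301),
   (32, 9, 2, 282716113104052101121116273120210501),
   (32, 12, 2, 140631292418192526080501072628270302061331043001),
   (32, 15, 2, 222807192106101104261516311701171130122521311615140213201801),
   (32, 18, 1, 61324072627150821200531111925171201),
   (32, 21, 2, 192312070417312720110609162513280326052101183120072329250504131415191211162721092801),
   (32, 24, 2, 180807302305312410132502092928170322141511210401061021042627181511222817310312192914090720232501),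
   (32, 27, 2, 262215280607121130212917093120270523021325100419160301100525310218272223081109141630291317072003241512192101),
   (32, 30, 1, 271230070417050629252326311024132803090214222108182015191101),
   (33, 10, 3, 83127192025060432010513323023252603020114082829021007323101),
   (33, 14, 3, 282332032725243029113106090124322022180809100517231504012510273208021312280506162101),
   (33, 18, 1, 71830063220112627241312152209032101),
   (33, 22, 3, 311307263012321009270208061503291720211824011330063125272417202104071405260903161232110113303223222128092720182419260615020316071201),
   (33, 26, 3, 151303261723301020251407023208160411052228293118190103140825240710272226191130310513230204321728061609010527192208282607291210232002312117250611161514321801),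
   (33, 30, 1, 300702082410030418063105162527121128262314293221151909172201),
   (34, 12, 2, 212026253308280309061401260631252820331314080901),
   (34, 18, 1, 282326040311052733302229060712083101),
   (34, 24, 2, 232824212526311004220318300629050833151216191701093008321531191817021005111204130329242622331601),
   (34, 30, 1, 321025043133202611181202030723152422061413091908281627302101),
   (35, 18, 1, 212420340903141504292625311132061001),
   (35, 30, 1, 121003081413150627302620332324310532071134212909042825022201),
   (36, 7, 6, 82333352019013435171013210135272829191801020326073528010835161528290109080735181701),
   (36, 8, 3, 333214350304190115143521221804011532351817212201),
   (36, 9, 2, 192423351231181301242305171835121301),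
   (36, 10, 2, 3309323135041312240132352327241203040501),
   (36, 11, 4, 926201924123135160601321224201935160405170120313010193527111617012009083505251617272801),
   (36, 12, 2, 80723153427352829021701281320192108090735162901),
   (36, 13, 2, 212242608110328181034350135340624121830282533080201),
   (36, 14, 3, 70302353304232605223428290103131731210807352315103334010806352813121419322930022401),
   (36, 15, 2, 122204353132181426071710242501050428181029192608121135243201),
   (36, 16, 2, 734292412053519061531020930130106351224231716212729303107052001),
   (36, 17, 4, 1815300413093226122414290531353401322422232728040510152103341208350109321522100621313318190413350302011402052631241207211735333223270401),
   (36, 18, 1, 41420131032332307062226033529163001),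
   (36, 19, 2, 219311734350930181224061533322529040135031821272622052412171914041107321001),
   (36, 20, 3, 293021032706353407283120252433181509120107081527203018122129092406260516110235010308151016072835113121292725053334090201),
   (36, 21, 2, 22017232131280710150803052633161834351101351015023305262524180619032921313413301201),
   (36, 22, 2, 2824120411192029342503270231230732080916350117280507273534201308252916141109122433220201),
   (36, 23, 4, 1011052406291316251507020920333218121735220401183432312908273025350402121928211011072426230126272032253523301814130309172904241216073405012611272909350323161819310633103402200713122401),
   (36, 24, 2, 161932020713332914350320212215060423250534300901153508062931202330021317333203161134282721070401),
   (36, 25, 2, 2234062618080224121415172531352111203028101627190132061128092510040530261514122402213518170819342201),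
   (36, 26, 3, 292332123322052614282731212420250315100835073404090109130632352131172924101514221205160427280226300708013306020903041012191411310724342605323027292835082201),
   (36, 27, 2, 340831273515100203291623282605042207201317092114183201281932051329152406263335312120301812270809042307101601),
   (36, 28, 2, 722113128241204092035231715162514211329020532080334270121021009072025112731330516230834190635262815293013122401),
   (36, 29, 4, 410340632333515172305132612241431212822073008290203251801342412100221202329152605192233353227181330060714310403160134270905191807293524263028150317221023080212112114061333013024211323282602033517222911143312061934083118090715102501),
   (36, 30, 1, 90425083519111512103321320507232602312728171629342403132001),
   (36, 31, 2, 1511062313173005343128160918271921323533020729201224080304250133050302170826131932212229312504231018280927071435241211153401),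
   (36, 32, 3, 81631240615112803203414231904223532212729173325130209301812070123240734111509222030213213270626172504030828290214161912350533011314183215202831302905211704252312342710160222241108190907350601),
   (36, 33, 2, 191322032334083309312135051218301002252826201115071714271606242901222724203319260514151029080731301718352821321203111316042509230601),
   (36, 34, 2, 806271731193533202309041421300207222615110316132412251032053428290120260915293127141910303221112303020616171224052213330807352825043401),
   (36, 35, 4, 1611182822351533312021251430082624342923091913050406270307171012023201233017261029323407250502043324270822130614281911311821203503120915160121303410182927033512242305162211281709333215310226071314062025081904010415353108300705201027142228230629192616211725113233241209023403181301),
   (37, 18, 1, 211832341617020523222036141903351501),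
   (37, 30, 1, 43210033630272202131911352028333407062426081715050929183101),
   (38, 12, 2, 351013123719230328252601130304191815343725352001),
   (38, 18, 1, 160631031537253210071312352822232601),
   (38, 24, 2, 323429281517112219330436351627093137020607251001322136222918313709052402231320112706071614190301),
   (38, 30, 1, 182335293624111737070906271305202132032602313025141215330801),
   (38, 36, 2, 310935202630131025141627230224112236210834330507061815280317293704123201303731362006341127132303122124181607080926292202332832143525171504100501),
   (39, 10, 3, 22937361338111603011405282737380810120138023130252623340901),
   (39, 14, 3, 353615101619180338293424210104051009061408330302383630010323332531062905343820363701),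
   (39, 18, 1, 333510171404373622323802060729250301),
   (39, 22, 3, 102438221335141525213337322912180406271708012521113231092629180417302210030238360705230103132226093807183402351429301716212810363701),
   (39, 26, 3, 370706142205092925280411311726182030353438022108330135101937360922140226380434170825311330272028321203012725081907352437121315113638323022173109020314040501),
   (39, 30, 1, 102520183122161529300826371905331709382306111321022834142401),
   (39, 34, 3, 142912322027173433352423263118160438151105032507372113102822360206010513362927071912021433280437340620093538081525263011172210243203160136260834351237100731303218290304133805223311211417062819252723020901),
   (39, 38, 3, 322009363802031233173508141037212730110529190425342306181615221326283107240137362330051714093238182216112910153525332819120421202434063127070802132603013331382302123425031137060716132609141828053017322420102135150836222729041901),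
   (40, 9, 2, 393820180325220201022237151820383901),
   (40, 12, 2, 151404332936100939302601103607110414392526303101),
   (40, 15, 2, 183933353421222320030929270601191302070637173905381120313401),
   (40, 18, 1, 62518172419343516331521053922072301),
   (40, 21, 2, 243527343815231920392105040633111617023601210420241918071308252339351636173205292201),
   (40, 24, 2, 20631132637161217111427253436242109052804383901393813271830342335041028190329063631122209150201),
   (40, 27, 2, 221239093833072728100435021114203430181903313606263701132033260403293130242139362228371606181407050912341001),
   (40, 30, 1, 130212393426371823312103292728300932060522191038111408173501),
   (40, 33, 2, 183803193733120414091139322821310502202223271036080729153526301701120231052025140930282938101907041739163735261118212423133603223301),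
   (40, 36, 2, 140431231635390930262736101924073422332806133217150325082137111812052901362237121116192733170838231518140324350729260405213130320913392825021001),
   (40, 39, 2, 340431193537220821332413321402052826181523291609392503381217111006072027363001100825033830310728091333392906173202052404181514362016211219271134233537222601)]

/-- Codes of non-orientable triangulations, in the same format as `orientableCodes`. -/
def nonorientableCodes : List (ℕ × ℕ × ℕ × ℕ) :=
  [(9, 8, 3, 30607080204050108040502070603010208040603070501),
   (10, 9, 2, 90205040708030601020604080905070301),
   (12, 7, 4, 2101107060501110504021008010204081011060111040210080701),
   (12, 8, 2, 6070804110903010511020306091001),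
   (12, 9, 2, 70810020411060501050611040210080701),
   (12, 10, 2, 709110302080406100110030205061109080401),
   (12, 11, 2, 6071003040811090205010907080203051104061001),
   (13, 12, 1, 110804090503021012060701),
   (14, 9, 2, 110413120710090201050703040212101301),
   (14, 12, 1, 50812110604130210090301),
   (15, 8, 3, 111207100314130104050603120914011014120508030201),
   (15, 10, 1, 8071404021311100501),
   (15, 12, 1, 80714050910040213110601),
   (15, 14, 3, 120403071013020605081109140110030712041311060814050902010910040212050308111413070601),
   (16, 9, 2, 41006121303151101040506031510131201),
   (16, 12, 1, 40503151114070902131201),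
   (16, 15, 1, 121013030602111507050414090801),
   (17, 12, 1, 90816040215131206110501),
   (18, 7, 6, 80717120605010817041514130109161712060501170612111413010211101703070111100907170401),
   (18, 8, 2, 13151716081002011603020506121701),
   (18, 9, 2, 111303040216141701151017160508070201),
   (18, 10, 2, 317020612141516040104061216151402170301),
   (18, 11, 2, 12081705041009070614010916081002111713120601),
   (18, 12, 1, 60210081604051713121401),
   (18, 13, 2, 212060804141016170507090117080414100916110213120601),
   (18, 14, 2, 10090817141106120507030415010917141116081002130703041501),
   (18, 15, 2, 101716090807121505030613110201110516131014040803150207091701),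
   (18, 16, 1, 13101114160204150506121707030801),
   (18, 17, 2, 17071108130406121603100502140915010212030411101617140715130509060801),
   (19, 12, 1, 100918110402171507081201),
   (19, 18, 1, 131508030516020607111417041218091001),
   (20, 9, 2, 191808041612100201021206140810181901),
   (20, 12, 1, 60702110918051913151401),
   (20, 15, 1, 121002060711191304180809161401),
   (20, 18, 1, 60809131607030519110417021415181201),
   (21, 8, 3, 151617192007060120040218050308010219161314200501),
   (21, 10, 1, 11102007141317040801),
   (21, 12, 1, 111020041617120615090501),
   (21, 14, 3, 21117181310080916032012070104151711080919201210060213012006101808051415041911031301),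
   (21, 16, 1, 5190811130304201716140702101801),
   (21, 18, 1, 111020170902161304030812141907051801),
   (21, 20, 3, 160310040813180719171214150509021106200107190906051317141103152008181210160402011608050617041807031013121411152019020901),
   (22, 9, 2, 122102111009201901131121182002040301),
   (22, 12, 1, 161702121020152105070601),
   (22, 15, 2, 140402201810160612080903072101081006190416132120121815140201),
   (22, 18, 1, 130805141904161518122106100917030701),
   (22, 21, 2, 131005161712030915182002041908072114110601081221051711030716130619091018200204141501),
   (23, 12, 1, 101413040221190922111201),
   (23, 18, 1, 121122201013030218091405071508162101),
   (24, 7, 4, 18230816151401191812062309010706052311100106181723131201),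
   (24, 8, 3, 181423220706200115050410091423011517231910090201),
   (24, 9, 2, 171523212010140401162303020908072201),
   (24, 10, 3, 130222212011122303011309081122202315040121131112230204031601),
   (24, 11, 2, 8161707101323031421011407232021111017030401),
   (24, 12, 1, 171813051116230619080701),
   (24, 13, 2, 1920101404230321081613090105060311202118230816150401),
   (24, 14, 2, 23220311041608122007210502010214171316192108031012222301),
   (24, 15, 1, 211408202306161204031718100701),
   (24, 16, 1, 15212206091005191423020816180301),
   (24, 17, 2, 19182207232113030902200816120406010811141202031617151823050621102201),
   (24, 18, 1, 111903041023200615091814130805162101),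
   (24, 19, 1, 8161722100615091804050723190212142001),
   (24, 20, 2, 7100208220623032114161817151909040520010722081614052021181703062319151002090401),
   (24, 21, 1, 211012221711140219202304031306150918070501),
   (24, 22, 1, 15220316081118142304100907132119200617020501),
   (24, 23, 2, 8112309180712192215061305031617022120101404011213210206201814150907230305171116081922041001),
   (25, 12, 1, 81817100520150724121301),
   (25, 18, 1, 40507102318032420021206191315222101),
   (25, 24, 1, 131224041916020715212018081109031710062214230501),
   (26, 9, 2, 21412242507211301251205181914130801),
   (26, 12, 1, 110214122409102516151701),
   (26, 15, 2, 151009051625031704022422130701172223142506192013091211210401),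
   (26, 18, 1, 70206250905240421192022171608181001),
   (26, 21, 2, 41502251903180913242322110817120620140501032504170921221311152316182408060710022001),
   (26, 24, 1, 180604071005211623190322021725140809111220241501),
   (27, 8, 3, 222305062621200107080904261822010506032421261901),
   (27, 10, 1, 23050409182226131401),
   (27, 12, 1, 141326150402252311121601),
   (27, 14, 3, 91008020506032421260719180122241106250314260219210508011508261725241920121316220301),
   (27, 16, 1, 5140304262322091813160819112401),
   (27, 18, 1, 90705161122022025181923040826131401),
   (27, 20, 3, 22616172213082319152010030412052507240103141124252610051915210612042320220717012623080424131603070209142205182017101101),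
   (27, 22, 1, 8171214162019091810222307260411251302150501),
   (27, 24, 1, 241121131610090403140820052326170619120715221801),
   (27, 26, 3, 161923171825221205210220151026090703140424110608130111120220140826151713162207090519251823042124030610010907211306191825102320022408042214152612110305171601),
   (28, 9, 2, 42726212524230201050704022624032701),
   (28, 12, 1, 60215132604052723222401),
   (28, 15, 1, 40516220612170327231114252401),
   (28, 18, 1, 260711030209082527192104161224172001),
   (28, 21, 1, 250709201602211817082427100304121426191101),
   (28, 24, 1, 81217101909180727032613150205162425231121200401),
   (28, 27, 1, 241516232712071719040521100211182006032522140826091301),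
   (29, 12, 1, 151428051120091823240601),
   (29, 18, 1, 192006182809151223142613160317111001),
   (29, 24, 1, 110609251028021620262714041315191824121705230301),
   (30, 7, 6, 82829050402012925240208060102101129282601120624181929012022232928020124222806072901),
   (30, 8, 2, 5252928141602012625201005042901),
   (30, 9, 2, 121126150419182901191511292814160201),
   (30, 10, 2, 216142829052010150129142010242515160601),
   (30, 11, 2, 12210503191809102029012109141129282516270201),
   (30, 12, 1, 252602161428242904060501),
   (30, 13, 2, 215102005121328291923180129171525072628020411102001),
   (30, 14, 2, 20101119121729280718050902011826212311220425131208192901),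
   (30, 15, 2, 21017161513222007210828291401291323140217091618240612281501),
   (30, 16, 1, 5211114092010190304292625162701),
   (30, 17, 2, 28191114181707041627210203261229011320102327292822110906081903240201),
   (30, 18, 1, 121725130814241610112919180522062001),
   (30, 19, 2, 209180821122010221305252423072829060129051020250812162321091722041826140701),
   (30, 20, 2, 6100905082524040228262029172227190323012126141108071020271612130529220325041801),
   (30, 21, 2, 60321021814122625242719281604291315110901052908110912161702212203271804192815261401),
   (30, 22, 1, 19022010121113040521172818292516230714092601),
   (30, 23, 2, 24281117070604130226092010192703291514220816010418102329151426272413200811211719060322121601),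
   (30, 24, 1, 131817052804271610111424262325122919030702062001),
   (30, 25, 2, 2703080426222502120624182010282321141315071629170117020923082629161020060304121314242705072815221801),
   (30, 26, 2, 27231718240612292611090719251504030222051308102028011306111808251722101519282102231220052407040326292701),
   (30, 27, 2, 102120112618150422051723191629031413081227020907282501172512202821230222100818130605031519092924072627110401),
   (30, 28, 1, 14061329112103052825231716222604082407022718191020091201),
   (30, 29, 2, 20101115070926021916130406051229242817182322252127140308011311270526152212142008230218102403172128160609041929072501),
   (31, 12, 1, 30518132629280230151601),
   (31, 18, 1, 110713220918252120270624041030151601),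
   (31, 24, 1, 180626110516173014131929210223270408101225201501),
   (31, 30, 1, 90726202104181503161924020830101427171328120525232229061101),
   (32, 9, 2, 70402302803053101063130272625290201),
   (32, 12, 1, 282627310504301517020601),
   (32, 15, 1, 180923141511121628173120042101),
   (32, 18, 1, 131718060329261231142019040230281501),
   (32, 21, 1, 151329021916030514310820122423181730270901),
   (32, 24, 1, 131114242804082217051520193029181027123102210301),
   (32, 27, 1, 171907110308290504251230132018092314021516312724212801),
   (32, 30, 1, 101129093121182613190624280408140312053015170207272520232201),
   (33, 8, 3, 30704303132050132292827300306010232040329263001),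
   (33, 10, 1, 28221106052732161701),
   (33, 12, 1, 171632051914282730030601),
   (33, 14, 3, 111209060823022703243021320122231412101817321525312102011827300306241032311909151601),
   (33, 16, 1, 26151625321709211224080722111801),
   (33, 18, 1, 121317071132200426100528231629222101),
   (33, 20, 3, 50616252110273223152602200818112212040128292312251009072211211315320217183124011618240829303115061022112317092704320301),
   (33, 22, 1, 17163224021404123122110908291005282319212501),
   (33, 24, 1, 51129280614150432182227081724160720132609251901),
   (33, 26, 3, 91417223206252405150228113126271929162018230408100123042022171832151410281903112631132925020830160507011929041713022811101408320927252215063123241807051601),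
   (33, 28, 1, 13273003061921201402112224171825290408260931123215071601),
   (33, 30, 1, 121627091429171132021013083130202819150622210418240525230301),
   (33, 32, 3, 230726192715111632311002281322201725062124053009142918120308040117101121200522041824270903160831260714021330061519282529231232011318050714082523211926161728152009061022320327042930241131120201),
   (34, 9, 2, 22925262732330801330705303202040901),
   (34, 12, 1, 100809332524321618022601),
   (34, 15, 2, 21228180624221610323307250301330216091220182726143231220801),
   (34, 18, 1, 270928201024140807161506263318251901),
   (34, 21, 2, 173328191131050625103023202415132704140301181716330221140308232007113132190915262901),
   (34, 24, 1, 202127121823312603291108051628071933130622151401),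
   (34, 27, 2, 90323190613280724322533221411122602273120081017052101262528122916221727211504070908332031061813141130032301),
   (34, 30, 1, 60331282914072720152521222602181632240930081019053312041301),
   (34, 33, 2, 143015130327080510090225281123320712332429222120161706312619041801133317231230140802212431100715193206262820160418221109032905272501),
   (35, 12, 1, 142221080431271334171801),
   (35, 18, 1, 181734020632330415262931112024090301),
   (35, 24, 1, 42805162613220925233011071202033432312419103301),
   (35, 30, 1, 101614082007111328040326250627120934312402212919332215233201),
   (36, 7, 4, 2083028223501232412351802011314063435190135341617182001),
   (36, 8, 3, 80935272628020110023534262928010310083433073501),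
   (36, 9, 2, 280908173527191801181927351708092801),
   (36, 10, 3, 331112131403043524010524230217123522250113153421193132352301),
   (36, 11, 2, 8292821141523350722012412132829150735210801),
   (36, 12, 1, 272802191734263508100901),
   (36, 13, 2, 416313513093332122420150132232221050427241203351401),
   (36, 14, 2, 16353421201917241229092302011734202714160719022213153501),
   (36, 15, 1, 330218201026163431323504030501),
   (36, 16, 1, 9100231241207052934083526282701),
   (36, 17, 2, 21352319071108321620041224280317012219203516151433253213122904172401),
   (36, 18, 1, 161415352120341130170623251913022201),
   (36, 19, 1, 28113216200415273517252112240908191801),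
   (36, 20, 2, 6321004143511182928132309313026222108011523102832040818261322271405350725241201),
   (36, 21, 1, 173020191327281810163508260623142511220901),
   (36, 22, 1, 15032034271916143528090708173312242122022901),
   (36, 23, 2, 25061117232227180935162832040824122019300514011002182008341624351330190625310927262812111701),
   (36, 24, 1, 152408102712200302281619092122112514353317263401),
   (36, 25, 1, 22112514150533092831102313262135181708031224271901),
   (36, 26, 2, 14192412313335270434032129181115060205222332300925013403020517313318150809133524201112322127160425072801),
   (36, 27, 1, 60921110422122733053507321814261524102529283130030801),
   (36, 28, 1, 7261130291925151322241234211017063527140223090804322801),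
   (36, 29, 2, 3132021260822142818103109040234320511122435173023062916012530042812082034331006312722023515051416243226230713191801),
   (36, 30, 1, 330723210215171222112514262916082820133419313235040310240501),
   (36, 31, 1, 6142723093234020413222817331520031821053511191631300825241201),
   (36, 32, 2, 33211516270702053403281810321325170414232412352011082622091929011327101726070819231215301609253331292014323528112403041822062101),
   (36, 33, 1, 251015260512112131072319162924352733170422300320133218140809062801),
   (36, 34, 1, 11302314092231282102122426251934103532162004030829061715071327053301),
   (36, 35, 2, 7103120111627250602193032142913080924122126331734041822150335230528010410021117191623311813123332063527150525093408221428263029032007212401),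
   (37, 12, 1, 221615313403062136181901),
   (37, 18, 1, 301605282936080723321124132621140901),
   (37, 24, 1, 92928203230121708362102071935052518161526112201),
   (37, 30, 1, 262805291308210211120631253617271020193509140730233224161801),
   (37, 36, 1, 150513232227143608321024292812301907260603343120040235331625181117210901),
   (38, 9, 2, 22724253637031401371311353436020401),
   (38, 12, 1, 293002201836283708100901),
   (38, 15, 2, 363126372320111205291803023301270914153537321622060507332401),
   (38, 18, 1, 242516073423371329220931270411151401),
   (38, 21, 2, 23424071608302229211410093236372804061501371410022204283009311708362016183424232901),
   (38, 24, 1, 282412261404353023222737150703331110343108051601),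
   (38, 27, 2, 302517323136201028181621241226143505220233080937062301103604202628293722180602123234161521080317333013050701),
   (38, 30, 1, 100703313409372105320823153024130435282925110614273316172201),
   (38, 33, 2, 173133352005110227240737211403231815063412222610041628320936251301080434303117163712252613113520063315182407020536032329273214212201),
   (38, 36, 1, 362508120915333426353704301707270203290622163223181113212814241031200501),
   (39, 8, 3, 211918373822230138161736200323010220382219161701),
   (39, 10, 1, 20193806132632330701),
   (39, 12, 1, 261413273306122538192001),
   (39, 14, 3, 283833202221081904050626180129170219133111120633273834012820242212111027381737153501),
   (39, 16, 1, 23102122381716261329112514281801),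
   (39, 18, 1, 300508373631293802100914073225340301),
   (39, 20, 3, 343033263822180736063214100309042128290127262018253505300221071312381011091423011333382837190605351716303425090429321101),
   (39, 22, 1, 26131417183437302305032538211607093202362201),
   (39, 24, 1, 261625381729131430152409231027060336332122121801),
   (39, 26, 3, 71315092808363129380630193724333225141103342204200130142124263833050611253615021009231920312803183207012705083713121721022633320638191120183516250714283401),
   (39, 28, 1, 27022114121326383218203015240929233108160607253719103301),
   (39, 30, 1, 161731250833211102320515382214062734102830370907121829242301),
   (39, 32, 3, 221315181729270725110608041423201912023305282637240338213635160104201705323323342814111302263531371027361630031938062925091222012032181730043510161137242319362514213815130926022803222734120701),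
   (39, 34, 1, 15103720320634242528332613072729051136182103143822021219171608312301),
   (39, 36, 1, 201938152902110632142423182510120417093727312226330521071335083028341601),
   (39, 38, 3, 272018221519142333360306290221042407093438321213313537302505172610281608110135040232261520341210163013230607193727220925052411381429283618210331081733011223310907333603061328271121080405141934203517320237302216291826381024251501),
   (40, 9, 2, 393618220403333101020910073839303701),
   (40, 12, 1, 363735390338192102050401),
   (40, 15, 1, 82931380907392019110233322101),
   (40, 18, 1, 312814261203271613293039100937241101),
   (40, 21, 1, 120802232928361822043234113919170638212001),
   (40, 24, 1, 82324283707391604340912363033321506100331251701),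
   (40, 27, 1, 202128142612330838271113241507193930322509100229163101),
   (40, 30, 1, 111421302903153110393319092436182204282516123726070623173401),
   (40, 33, 1, 183037212707102817393413203303243809141619060531291222231102263501),
   (40, 36, 1, 303314311816121726191322383203101108062709233536240234210737293904280501),
   (40, 39, 1, 371336393432112602081912300728180931221017040316142520050638242723332129153501)]

lemma checkOrientable_codes :
    (orientableCodes.all fun t => checkOrientable t.1 t.2.1 t.2.2.1 t.2.2.2) = true := by
  decide +kernel

lemma checkNonorientable_codes :
    (nonorientableCodes.all fun t => checkNonorientable t.1 t.2.1 t.2.2.1 t.2.2.2) = true := by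
  decide +kernel

/-- The codes of orientable triangulations cover all cases in which the Euler characteristic
`n * (6 - q) / 6` is an even integer. -/
lemma orientableCodes_cover : ∀ n ≤ 40, ∀ q < n, 7 ≤ q → 12 ∣ n * (q - 6) →
    (orientableCodes.any fun t => Nat.beq t.1 n && Nat.beq t.2.1 q) = true := by
  decide +kernel

/-- The codes of non-orientable triangulations cover all cases in which the Euler characteristic
`n * (6 - q) / 6` is an integer. -/
lemma nonorientableCodes_cover : ∀ n ≤ 40, ∀ q < n, 7 ≤ q → 6 ∣ n * (q - 6) →
    (nonorientableCodes.any fun t => Nat.beq t.1 n && Nat.beq t.2.1 q) = true := by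
  decide +kernel

theorem exists_orientable_of_dvd {n q : ℕ} (hn : n ≤ 40) (hqn : q < n) (hq : 7 ≤ q)
    (hdvd : 12 ∣ n * (q - 6)) :
    ∃ K : AbstractSimplicialComplex (Fin n), K.IsSurfaceTriangulation ∧
      6 * K.eulerChar = n * (6 - q : ℤ) ∧ K.IsOrientable ∧ K.IsEquivelar q := by
  obtain ⟨⟨n', q', k, c⟩, ht, h⟩ := List.any_eq_true.1 (orientableCodes_cover n hn q hqn hq hdvd)
  have hc := List.all_eq_true.1 checkOrientable_codes _ ht
  simp only [Bool.and_eq_true, Nat.beq_eq] at h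
  obtain ⟨rfl, rfl⟩ := h
  exact exists_orientable_of_check (by omega) (by omega) hc

theorem exists_nonorientable_of_dvd {n q : ℕ} (hn : n ≤ 40) (hqn : q < n) (hq : 7 ≤ q)
    (hdvd : 6 ∣ n * (q - 6)) :
    ∃ K : AbstractSimplicialComplex (Fin n), K.IsSurfaceTriangulation ∧
      6 * K.eulerChar = n * (6 - q : ℤ) ∧ ¬ K.IsOrientable ∧ K.IsEquivelar q := by
  obtain ⟨⟨n', q', k, c⟩, ht, h⟩ :=
    List.any_eq_true.1 (nonorientableCodes_cover n hn q hqn hq hdvd)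
  have hc := List.all_eq_true.1 checkNonorientable_codes _ ht
  simp only [Bool.and_eq_true, Nat.beq_eq] at h
  obtain ⟨rfl, rfl⟩ := h
  exact exists_nonorientable_of_check (by omega) (by omega) hc

/-- The bound on `n` in the definition of an admissible triple says that `q ≤ n - 1`: the degree of
a vertex is less than the number of vertices. -/
lemma IsAdmissibleTriple.arith {χ : ℤ} {q n : ℕ} (h : IsAdmissibleTriple χ q n) :
    7 ≤ q ∧ q < n ∧ 6 * χ = n * (6 - q : ℤ) := by
  obtain ⟨hχ, hn, hq⟩ := h
  have hχ' : (χ : ℝ) < 0 := by exact_mod_cast hχ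
  have hle : (7 + √(49 - 24 * (χ : ℝ))) / 2 ≤ (n : ℝ) := by
    exact_mod_cast Int.ceil_le.1 hn
  have hsqrt : √(49 - 24 * (χ : ℝ)) ≤ 2 * n - 7 := by linarith
  have hs0 := Real.sqrt_nonneg (49 - 24 * (χ : ℝ))
  have hsq : 49 - 24 * (χ : ℝ) ≤ (2 * n - 7) ^ 2 :=
    (Real.sqrt_le_left (by linarith)).1 hsqrt
  have hn0 : (0 : ℝ) < n := by linarith
  have hmul : 6 * (χ : ℝ) = n * (6 - q) := by
    rw [hq]
    field_simp
    ring
  have hmul' : 6 * χ = n * (6 - q : ℤ) := by exact_mod_cast hmul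
  refine ⟨?_, ?_, hmul'⟩
  · by_contra! hlt
    have : (0 : ℤ) ≤ n * (6 - q : ℤ) := mul_nonneg (by positivity) (by omega)
    omega
  · have : (n : ℝ) * q ≤ n * (n - 1) := by nlinarith
    have := le_of_mul_le_mul_left this hn0
    have : (q : ℝ) < n := by linarith
    exact_mod_cast this

theorem mainTheorem4 (χ : ℤ) (q n : ℕ) (hadm : IsAdmissibleTriple χ q n) (hn : n ≤ 40) :
    (∃ K : AbstractSimplicialComplex (Fin n),
      K.IsSurfaceTriangulation ∧ K.eulerChar = χ ∧ ¬ K.IsOrientable ∧ K.IsEquivelar q) ∧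
    (Even χ → ∃ K : AbstractSimplicialComplex (Fin n),
      K.IsSurfaceTriangulation ∧ K.eulerChar = χ ∧ K.IsOrientable ∧ K.IsEquivelar q) := by
  obtain ⟨hq, hqn, hχ⟩ := hadm.arith
  have hcast : ((n * (q - 6) : ℕ) : ℤ) = 6 * -χ := by
    rw [Nat.cast_mul, Nat.cast_sub (by omega)]
    push_cast
    linear_combination hχ
  constructor
  · obtain ⟨K, h1, h2, h3⟩ := exists_nonorientable_of_dvd hn hqn hq (by omega)
    exact ⟨K, h1, by omega, h3⟩
  · rintro ⟨m, hm⟩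
    obtain ⟨K, h1, h2, h3⟩ := exists_orientable_of_dvd hn hqn hq (by omega)
    exact ⟨K, h1, by omega, h3⟩
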